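/- **Setting.** There are $K\ge 2$ arms; a play of arm $k$ that is not disturbed yields an independent reward from a law on $[0,1]$ with mean $\mu_k$. Two or more players who select the same arm in the same round collide and all receive nothing. Let $\varepsilon>0$ be such that any two means differ by more than $\varepsilon$, i.e. $\varepsilon<\Delta_m$, where $\Delta_m$ is the smallest gap between consecutive means in sorted order. Let $N_t\le K$ players be present in round $t$, $1\le t\le T$, $T\ge 2$. During the $T$ rounds at most $x\ge 1$ players enter (after the first round) and at most $x$ leave, at times that are fixed in advance. With $I_{j,t}$ the arm selected by player $j$ in round $t$, $\eta_{j,t}\in\{0,1\}$ her collision indicator, and $K_t^*$ the set of the $N_t$ arms with the highest means, the (expected) regret and the number of collisions are $$R=\sum_{t=1}^T\sum_{k\in K_t^*}\mu_k-\sum_{t=1}^T\sum_{j}\mu_{I_{j,t}}(1-\eta_{j,t}),\qquad C=\sum_{t=1}^T\sum_j\eta_{j,t},$$ where $j$ runs over the players present in round $t$ (a player who plays no arm earns $0$). **Algorithm (Dynamic Trekking, DT).** For $\delta\in(0,1)$ let $$T_0=\left\lceil\frac{\log(\delta/(2KT))}{\log(1-1/(4K))}\right\rceil+\left\lceil\frac{2K}{\varepsilon^2}\log\frac{4K^2T}{\delta}\right\rceil,\qquad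 T_{ep}=\max\left(T_0,\left\lceil\sqrt{\frac{TK(T_0+T_{tr})}{2x}}\right\rceil\right),$$ with $T_{tr}=K^2/2+1$ for upward trekking and $T_{tr}=(K-1)^2+1$ for downward trekking. Time is divided into epochs of $T_{ep}$ rounds, and every player present at the beginning of an epoch restarts the following procedure. *Learning* ($T_0$ rounds): the player plays uniformly random arms up to and including her first collision-free play; from then on she plays the arms cyclically, $k\mapsto k+1$ modulo $K$. Then she ranks the arms by $\hat\mu_k=V_k/S_k$, where $V_k$ is the reward she collected from arm $k$ and $S_k$ the number of times she selected it (ties are broken by index). Let $i$ be the rank of the arm she played last. If $i=1$, she plays that arm until the end of the epoch. Otherwise she starts one of the following two trekking procedures, the same for all players; once *locked* on an arm, a player plays it until the end of the epoch. *Upward trekking:* with reserved arm of rank $i\ge 2$, she plays the arm of rank $i-1$ for $i-1$ rounds. At a collision she returns to the reserved arm and is locked on it; without collision the arm of rank $i-1$ becomes her reserved arm, and she is locked on it if $i-1=1$, and continues otherwise. *Downward trekking:* she tries the arms of ranks $1,2,\dots$ in turn; a collision-free play locks her on the arm, and after $K-i+1$ collisions on it she moves to the next one. Nobody enters during the first $T_0+T_{tr}$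 rounds of an epoch, except at its very beginning; players may leave at any time. Until the next epoch begins, a player who has entered in the middle of an epoch may behave arbitrarily (play any arms or none). **Theorem.** For either trekking procedure, $R\le\tilde O(\sqrt{xT})$ and $C\le\tilde O(\sqrt{xT})$ with probability at least $1-\delta$, where $\tilde O$ hides logarithmic factors in $T$. Precisely: there is a universal $p\in\mathbb N$, and for all $K,\varepsilon,\delta$ and either trekking procedure there is a constant $A$, such that for all $T\ge2$, all $x\ge1$, all reward laws, all entering and leaving times and all behaviours of waiting players as above, there is an event of probability at least $1-\delta$ on which $$R\le A\sqrt{xT}\,(\log T)^p\quad\text{and}\quad C\le A\sqrt{xT}\,(\log T)^p .$$ -/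

import Mathlib

open MeasureTheory ProbabilityTheory

namespace DynTrek

/-- The two trekking subroutines: upwards (TrekU) and downwards with back-off (TrekD). -/
inductive Trek
  | up
  | down

/-- Length `T_0(δ')` of the learning phase for `K` arms, accuracy `ε` and confidence `δ'`:
`⌈log (δ'/2K) / log (1 - 1/4K)⌉ + ⌈(2K/ε²) log (4K²/δ')⌉`. -/
noncomputable def learnLen (K : ℕ) (ε δ' : ℝ) : ℕ :=
  ⌈Real.log (δ' / (2 * K)) / Real.log (1 - 1 / (4 * K))⌉₊ +
    ⌈2 * K / ε ^ 2 * Real.log (4 * (K : ℝ) ^ 2 / δ')⌉₊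

/-- The constant `T_tr` bounding the number of trekking rounds, valid for every number
`1 ≤ N ≤ K` of players: the maximum over `N` of `(K² - (N-1)²)/2 + 1` for upward trekking and of
`(N-1)(K-1) + 1` for downward trekking. -/
noncomputable def trekLen (K : ℕ) : Trek → ℝ
  | .up => (K : ℝ) ^ 2 / 2 + 1
  | .down => ((K : ℝ) - 1) * ((K : ℝ) - 1) + 1

/-- Epoch length `T_ep = √(T K (T_0 + T_tr) / (2 x))`, rounded up to an integer, and replaced by
`T_0` when it is smaller than `T_0`. -/
noncomputable def epochLen (K T x T₀ : ℕ) (Ttr : ℝ) : ℕ :=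
  max T₀ ⌈Real.sqrt (T * K * (T₀ + Ttr) / (2 * x))⌉₊

/-- Local memory of a player in the learning phase: the arm played last, the indicator `L` (a
collision-free play has been observed), the accumulated reward `V k` and the number of plays
`S k` of each arm. -/
structure LearnState (K : ℕ) where
  last : Fin K
  L : Bool
  V : Fin K → ℝ
  S : Fin K → ℕ

/-- Local memory of a player in the trekking phase.  Ranks start from `0` (the best arm).
`order r` is the arm that the player ranks at position `r`.
Upward: `rank` is the rank of the reserved arm, and an unlocked player probes the arm of rank
`rank - 1`.  Downward: `rank` is the rank of the arm that is being tried.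
`count` is the number of rounds already spent on the arm that is probed or tried;
`backoff` is only used by downward trekking. -/
structure TrekState (K : ℕ) where
  order : Equiv.Perm (Fin K)
  rank : Fin K
  count : ℕ
  backoff : ℕ
  locked : Bool

/-- A player is waiting for the next epoch (or absent), learning, or trekking. -/
inductive PlayerState (K : ℕ)
  | waiting
  | learning (s : LearnState K)
  | trekking (s : TrekState K)

/-! ### The learning phase -/

/-- Memory at the start of an epoch (the value of `last` is not used while `L = false`). -/
def LearnState.init (K : ℕ) [NeZero K] : LearnState K :=
  { last := 0, L := false, V := fun _ => 0, S := fun _ => 0 }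

/-- Next arm: sequential (modulo `K`) if `L` is set, otherwise the uniform draw `u`. -/
def LearnState.arm {K : ℕ} [NeZero K] (s : LearnState K) (u : Fin K) : Fin K :=
  if s.L then s.last + 1 else u

/-- Update after playing arm `a` with collision indicator `c`; `y` is the reward of that arm, which
is received only if there is no collision. -/
noncomputable def LearnState.next {K : ℕ} (s : LearnState K) (a : Fin K) (c : Bool) (y : ℝ) :
    LearnState K :=
  { last := a
    L := s.L || !c
    V := if c then s.V else Function.update s.V a (s.V a + y)
    S := Function.update s.S a (s.S a + 1) }

/-- Arms in decreasing order of the estimates `V k / S k` (ties broken by the index). -/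
noncomputable def LearnState.ranking {K : ℕ} (s : LearnState K) : Equiv.Perm (Fin K) :=
  Tuple.sort (fun k => -(s.V k / (s.S k : ℝ)))

/-! ### The trekking phase -/

/-- The rank that is one position better. -/
def better {K : ℕ} (r : Fin K) : Fin K := ⟨r.1 - 1, lt_of_le_of_lt (Nat.sub_le _ _) r.2⟩

/-- Memory at the start of the trekking phase.  If the arm played last in the learning phase is
ranked first, the player is locked on it.  Otherwise the upward player takes that arm as her
reserved arm, and the downward player starts from the best arm, with back-off time `K - i + 1`
if her last arm has position `i` when positions are counted from `1`. -/
noncomputable def TrekState.init {K : ℕ} [NeZero K] (v : Trek) (s : LearnState K) : TrekState K :=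
  let J : Fin K := s.ranking.symm s.last
  { order := s.ranking
    rank := match v with
      | .up => J
      | .down => 0
    count := 0
    backoff := K - J.1
    locked := decide (J.1 = 0) }

/-- The arm played by a trekking player. -/
def TrekState.arm {K : ℕ} (v : Trek) (s : TrekState K) : Fin K :=
  match v with
  | .up => s.order (if s.locked then s.rank else better s.rank)
  | .down => s.order s.rank

/-- Update after a trekking round with collision indicator `c`.  A locked player stays locked.
Upward: with the reserved arm in position `i ≥ 2` (counted from `1`), a collision makes the player
return to it and lock; after `i - 1` collision-free rounds on the arm in position `i - 1` that arm
becomes the reserved arm, and she locks if it is the top arm.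
Downward: a collision-free play locks the player on the arm; after `backoff` collisions she moves
to the next worse arm (she stays if there is none). -/
def TrekState.next {K : ℕ} (v : Trek) (s : TrekState K) (c : Bool) : TrekState K :=
  if s.locked then s else
  match v with
  | .up =>
      if c then { s with locked := true }
      else if s.count + 1 < s.rank.1 then { s with count := s.count + 1 }
      else { s with rank := better s.rank, count := 0, locked := decide ((better s.rank).1 = 0) }
  | .down =>
      if !c then { s with locked := true }
      else if s.count + 1 < s.backoff then { s with count := s.count + 1 }
      else if h : s.rank.1 + 1 < K then { s with rank := ⟨s.rank.1 + 1, h⟩, count := 0 }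
      else { s with count := 0 }

/-! ### The dynamic game -/

/-- All data that determine one run of the algorithm among the players `ι`, with rounds
`t = 0, 1, 2, …`.  Player `j` is in the game in the rounds `arr j ≤ t < dep j`; `U j t` is her
uniform draw in round `t`; `X j t k` is the reward that arm `k` yields to her in round `t` if she
plays it without collision; `W j t` is what she does in round `t` if she has entered in the middle
of the current epoch and waits for the next one (`none` means that she plays no arm). -/
structure Run (ι : Type*) (K : ℕ) where
  v : Trek
  T₀ : ℕ
  Tep : ℕ
  arr : ι → ℕ
  dep : ι → ℕ
  U : ι → ℕ → Fin K
  X : ι → ℕ → Fin K → ℝ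
  W : ι → ℕ → Option (Fin K)

namespace Run

variable {ι : Type*} [Fintype ι] [DecidableEq ι] {K : ℕ} [NeZero K]

/-- The players who are in the game in round `t`; its cardinality is `N_t`. -/
def present (R : Run ι K) (t : ℕ) : Finset ι :=
  Finset.univ.filter (fun j => R.arr j ≤ t ∧ t < R.dep j)

/-- Beginning of round `t` for player `j`: every player who is in the game starts learning when an
epoch begins, and passes from learning to trekking after `T₀` rounds of the epoch. -/
noncomputable def start (R : Run ι K) (t : ℕ) (j : ι) (s : PlayerState K) : PlayerState K :=
  if j ∈ R.present t then
    if t % R.Tep = 0 then .learning (LearnState.init K)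
    else if t % R.Tep = R.T₀ then
      match s with
      | .learning l => .trekking (TrekState.init R.v l)
      | s => s
    else s
  else .waiting

/-- The arm selected by player `j` in round `t`, given the states of the players. -/
def choose (R : Run ι K) (t : ℕ) (st : ι → PlayerState K) (j : ι) : Option (Fin K) :=
  if j ∈ R.present t then
    match st j with
    | .waiting => R.W j t
    | .learning l => some (l.arm (R.U j t))
    | .trekking s => some (s.arm R.v)
  else none

/-- Collision indicator of player `j` when the arms `c` are selected. -/
def collides (c : ι → Option (Fin K)) (j : ι) : Bool :=
  decide (c j ≠ none ∧ ∃ i, i ≠ j ∧ c i = c j)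

/-- State of player `j` after round `t`. -/
noncomputable def finish (R : Run ι K) (t : ℕ) (st : ι → PlayerState K) (j : ι) : PlayerState K :=
  let c := collides (R.choose t st) j
  match st j with
  | .waiting => .waiting
  | .learning l =>
      let a := l.arm (R.U j t)
      .learning (l.next a c (R.X j t a))
  | .trekking s => .trekking (s.next R.v c)

/-- The states of all players at the time when they choose an arm in round `t`. -/
noncomputable def state (R : Run ι K) : ℕ → ι → PlayerState K
  | 0 => fun j => R.start 0 j .waiting
  | t + 1 => fun j => R.start (t + 1) j (R.finish t (R.state t) j)

/-- The arm `I_{j,t}`. -/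
noncomputable def arm (R : Run ι K) (t : ℕ) (j : ι) : Option (Fin K) := R.choose t (R.state t) j

/-- The collision indicator `η_{j,t}`. -/
noncomputable def eta (R : Run ι K) (t : ℕ) (j : ι) : ℕ := if collides (R.arm t) j then 1 else 0

end Run

/-- The set of the `n` arms with the highest means (for pairwise distinct means `μ`). -/
noncomputable def topArms {K : ℕ} (μ : Fin K → ℝ) (n : ℕ) : Finset (Fin K) :=
  Finset.univ.filter (fun k => (Finset.univ.filter (fun i => μ k < μ i)).card < n)

/-- The mean of the selected arm (`0` if no arm is played). -/
def meanOf {K : ℕ} (μ : Fin K → ℝ) : Option (Fin K) → ℝ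
  | some k => μ k
  | none => 0

/-- The (expected) regret
`R = ∑_t ∑_{k ∈ K*_t} μ_k - ∑_t ∑_j μ_{I_{j,t}} (1 - η_{j,t})` over `T` rounds. -/
noncomputable def Run.regret {ι : Type*} [Fintype ι] [DecidableEq ι] {K : ℕ} [NeZero K]
    (R : Run ι K) (μ : Fin K → ℝ) (T : ℕ) : ℝ :=
  (∑ t ∈ Finset.range T, ∑ k ∈ topArms μ (R.present t).card, μ k) -
    (∑ t ∈ Finset.range T, ∑ j ∈ R.present t, meanOf μ (R.arm t j) * (1 - (R.eta t j : ℝ)))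

/-- The number of collisions `C = ∑_t ∑_j η_{j,t}` over `T` rounds. -/
noncomputable def Run.collisions {ι : Type*} [Fintype ι] [DecidableEq ι] {K : ℕ} [NeZero K]
    (R : Run ι K) (T : ℕ) : ℕ :=
  ∑ t ∈ Finset.range T, ∑ j ∈ R.present t, R.eta t j

/-- The standing assumptions on the times at which players enter and leave: never more players than
arms; at most `x` players enter after the first round and at most `x` leave during the `T` rounds;
nobody enters during the learning and trekking phases of an epoch, except at its beginning. -/
structure Admissible {ι : Type*} [Fintype ι] (K T x T₀ Tep : ℕ) (Ttr : ℝ) (arr dep : ι → ℕ) :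
    Prop where
  card_le : ∀ t < T, (Finset.univ.filter (fun j => arr j ≤ t ∧ t < dep j)).card ≤ K
  enter_le : (Finset.univ.filter (fun j => 0 < arr j ∧ arr j < T)).card ≤ x
  leave_le : (Finset.univ.filter (fun j => dep j < T)).card ≤ x
  enter_time : ∀ j, arr j < T → arr j % Tep = 0 ∨ (T₀ : ℝ) + Ttr ≤ ((arr j % Tep : ℕ) : ℝ)

/-- The random inputs of the game: uniform draws `U` and rewards `X`, where the rewards of arm `k`
have law `ν k`; all of them independent over players, rounds and arms. -/
structure RandomInputs {Ω : Type*} [MeasurableSpace Ω] (P : Measure Ω) {ι : Type*} {K : ℕ}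
    (ν : Fin K → Measure ℝ) (U : ι → ℕ → Ω → Fin K) (X : ι → ℕ → Fin K → Ω → ℝ) : Prop where
  meas_U : ∀ j t, Measurable (U j t)
  law_U : ∀ j t k, P (U j t ⁻¹' {k}) = (K : ENNReal)⁻¹
  meas_X : ∀ j t k, Measurable (X j t k)
  law_X : ∀ j t k, P.map (X j t k) = ν k
  indep_U : iIndepFun (fun (p : ι × ℕ) => U p.1 p.2) P
  indep_X : iIndepFun (fun (p : ι × ℕ × Fin K) => X p.1 p.2.1 p.2.2) P
  indep_UX : IndepFun (fun ω (p : ι × ℕ) => U p.1 p.2 ω)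
    (fun ω (p : ι × ℕ × Fin K) => X p.1 p.2.1 p.2.2 ω) P

/-- The run of Dynamic Trekking with horizon `T`, confidence `δ`, accuracy `ε` and bound `x`:
learning length `T₀ = T_0(δ/T)` and the epoch length `T_ep` computed from it. -/
noncomputable def dtRun {ι : Type*} {K : ℕ} (v : Trek) (ε δ : ℝ) (T x : ℕ) (arr dep : ι → ℕ)
    (U : ι → ℕ → Fin K) (X : ι → ℕ → Fin K → ℝ) (W : ι → ℕ → Option (Fin K)) : Run ι K :=
  { v := v
    T₀ := learnLen K ε (δ / T)
    Tep := epochLen K T x (learnLen K ε (δ / T)) (trekLen K v)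
    arr := arr
    dep := dep
    U := U
    X := X
    W := W }

end DynTrek

open DynTrek

namespace DynTrek

/-! ### The trekking phase among a fixed set of players -/

section Trekking

variable {ι : Type*} [DecidableEq ι] {K : ℕ}

/-- The trekking phase of the players `P` from the initial memories `s₀`. -/
def trekRun (v : Trek) (P : Finset ι) (s₀ : ι → TrekState K) : ℕ → ι → TrekState K
  | 0 => s₀
  | n + 1 => fun j => (trekRun v P s₀ n j).next v
      (decide (∃ i ∈ P, i ≠ j ∧ (trekRun v P s₀ n i).arm v = (trekRun v P s₀ n j).arm v))

/-- All players are locked on distinct arms, whose ranks are smaller than the number of players. -/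
def Settled (σ : Equiv.Perm (Fin K)) (P : Finset ι) (s : ι → TrekState K) : Prop :=
  (∀ j ∈ P, (s j).locked = true ∧ (s j).order = σ) ∧
    Set.InjOn (fun j => (s j).rank) (P : Set ι) ∧ ∀ j ∈ P, ((s j).rank : ℕ) < P.card

omit [DecidableEq ι] in
lemma lt_card_of_downward_closed {P : Finset ι} {r : ι → ℕ}
    (h : ∀ j ∈ P, ∀ m < r j, ∃ i ∈ P, r i = m) {j : ι} (hj : j ∈ P) : r j < P.card := by
  have hsub : Finset.range (r j + 1) ⊆ P.image r := by
    intro m hm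
    rw [Finset.mem_range] at hm
    rcases Nat.lt_succ_iff_lt_or_eq.1 hm with h1 | h1
    · obtain ⟨i, hi, rfl⟩ := h j hj m h1
      exact Finset.mem_image_of_mem _ hi
    · exact h1 ▸ Finset.mem_image_of_mem _ hj
  have := (Finset.card_le_card hsub).trans Finset.card_image_le
  rwa [Finset.card_range] at this

/-! #### Upward trekking -/

/-- Triangular numbers. -/
def tri : ℕ → ℕ
  | 0 => 0
  | n + 1 => tri n + (n + 1)

lemma tri_mono : Monotone tri := monotone_nat_of_le_succ fun _ => Nat.le_add_right _ _

lemma tri_pred {n : ℕ} (h : 0 < n) : tri n = tri (n - 1) + n := by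
  obtain ⟨m, rfl⟩ := Nat.exists_eq_succ_of_ne_zero h.ne'
  rfl

lemma tri_le_sq (n : ℕ) : tri n ≤ n * n := by
  induction n with
  | zero => simp [tri]
  | succ n ih => simp only [tri]; nlinarith

lemma le_tri (n : ℕ) : n ≤ tri n := by
  cases n <;> simp [tri]

/-- Invariant of upward trekking after `n` rounds. -/
structure UpInv (σ : Equiv.Perm (Fin K)) (P : Finset ι) (n : ℕ) (s : ι → TrekState K) : Prop where
  order : ∀ j ∈ P, (s j).order = σ
  count : ∀ j ∈ P, (s j).locked = false → (s j).count < (s j).rank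
  ahead : ∀ i ∈ P, ∀ j ∈ P, i ≠ j → (s i).locked = false → (s j).locked = false →
    tri (s i).rank + (s j).count + (s j).rank ≤ tri (s j).rank + (s i).count ∨
    tri (s j).rank + (s i).count + (s i).rank ≤ tri (s i).rank + (s j).count
  sep : ∀ i ∈ P, ∀ j ∈ P, (s i).locked = true → (s j).locked = false →
    ((s i).rank : ℕ) < (s j).rank
  inj : ∀ i ∈ P, ∀ j ∈ P, i ≠ j → (s i).locked = true → (s j).locked = true →
    ((s i).rank : ℕ) ≠ (s j).rank
  pred : ∀ j ∈ P, (s j).locked = true → 0 < ((s j).rank : ℕ) →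
    ∃ i ∈ P, (s i).locked = true ∧ ((s i).rank : ℕ) + 1 = (s j).rank
  time : ∀ j ∈ P, (s j).locked = false → tri (s j).rank + n ≤ tri K + (s j).count

lemma TrekState.next_locked {v : Trek} {s : TrekState K} {c : Bool} (h : s.locked = true) :
    s.next v c = s := by
  simp [TrekState.next, h]

lemma TrekState.next_order (v : Trek) (s : TrekState K) (c : Bool) :
    (s.next v c).order = s.order := by
  unfold TrekState.next
  cases v <;> dsimp only <;> split_ifs <;> rfl

lemma TrekState.next_up {s : TrekState K} (h : s.locked = false) (hc : s.count < s.rank)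
    (c : Bool) :
    (c = true ∧ (s.next .up c).locked = true ∧ ((s.next .up c).rank : ℕ) = s.rank) ∨
    (c = false ∧ s.count + 1 < s.rank ∧ (s.next .up c).locked = false ∧
      ((s.next .up c).rank : ℕ) = s.rank ∧ (s.next .up c).count = s.count + 1) ∨
    (c = false ∧ s.count + 1 = s.rank ∧ (s.rank : ℕ) = 1 ∧ (s.next .up c).locked = true ∧
      ((s.next .up c).rank : ℕ) = 0) ∨
    (c = false ∧ s.count + 1 = s.rank ∧ 1 < (s.rank : ℕ) ∧ (s.next .up c).locked = false ∧
      ((s.next .up c).rank : ℕ) + 1 = s.rank ∧ (s.next .up c).count = 0) := by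
  unfold TrekState.next
  rw [if_neg (by simp [h])]
  dsimp only
  cases c
  · by_cases h1 : s.count + 1 < s.rank
    · simp [h1, h]
    · have h2 : s.count + 1 = s.rank := by omega
      by_cases h3 : (s.rank : ℕ) = 1
      · refine .inr (.inr (.inl ⟨rfl, h2, h3, ?_, ?_⟩)) <;> simp [better, h3]
      · refine .inr (.inr (.inr ⟨rfl, h2, by omega, ?_, ?_, ?_⟩))
        · simp only [h1, Bool.false_eq_true, if_false, better]
          exact decide_eq_false (by omega)
        · simp only [h1, Bool.false_eq_true, if_false, better]
          omega
        · simp [h1]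
  · simp

/-- An unlocked upward player with rank `r` probes rank `r - 1`, a locked one plays rank `r`. -/
lemma TrekState.arm_up {σ : Equiv.Perm (Fin K)} {s s' : TrekState K} (h : s.order = σ)
    (h' : s'.order = σ) : s.arm .up = s'.arm .up ↔
      (if s.locked then (s.rank : ℕ) else s.rank - 1) =
        (if s'.locked then (s'.rank : ℕ) else s'.rank - 1) := by
  simp only [TrekState.arm, h, h', σ.injective.eq_iff, Fin.ext_iff]
  split_ifs <;> simp [better]

omit [DecidableEq ι] in
lemma UpInv.ahead_lt {σ : Equiv.Perm (Fin K)} {P : Finset ι} {n : ℕ} {s : ι → TrekState K}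
    (H : UpInv σ P n s) {i j : ι} (hi : i ∈ P) (hj : j ∈ P)
    (hil : (s i).locked = false) (hjl : (s j).locked = false)
    (h : tri (s i).rank + (s j).count + (s j).rank ≤ tri (s j).rank + (s i).count) :
    ((s i).rank : ℕ) < (s j).rank ∧ (((s i).rank : ℕ) + 1 = (s j).rank →
      (s j).count ≤ (s i).count) := by
  have h1 := H.count i hi hil
  have h2 := H.count j hj hjl
  have h3 := tri_pred (n := (s i).rank) (by omega)
  have h4 := tri_pred (n := (s j).rank) (by omega)
  constructor
  · by_contra hlt
    have := tri_mono (show ((s j).rank : ℕ) - 1 ≤ (s i).rank - 1 by omega)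
    omega
  · intro h5
    have h6 : ((s j).rank : ℕ) - 1 = (s i).rank := by omega
    rw [h6] at h4
    omega

omit [DecidableEq ι] in
lemma UpInv.collision {σ : Equiv.Perm (Fin K)} {P : Finset ι} {n : ℕ} {s : ι → TrekState K}
    (H : UpInv σ P n s) {j : ι} (hj : j ∈ P) (hjl : (s j).locked = false) :
    (∃ i ∈ P, i ≠ j ∧ (s i).arm .up = (s j).arm .up) ↔
      ∃ i ∈ P, (s i).locked = true ∧ ((s i).rank : ℕ) + 1 = (s j).rank := by
  have hc := H.count j hj hjl
  constructor
  · rintro ⟨i, hi, hij, ha⟩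
    rw [TrekState.arm_up (H.order i hi) (H.order j hj)] at ha
    cases hil : (s i).locked
    · have hci := H.count i hi hil
      rcases H.ahead i hi j hj hij hil hjl with h | h
      · have := H.ahead_lt hi hj hil hjl h
        simp only [hil, hjl, Bool.false_eq_true, if_false] at ha
        omega
      · have := H.ahead_lt hj hi hjl hil h
        simp only [hil, hjl, Bool.false_eq_true, if_false] at ha
        omega
    · simp only [hil, hjl, Bool.false_eq_true, if_false, if_true] at ha
      exact ⟨i, hi, hil, by omega⟩
  · rintro ⟨i, hi, hil, hr⟩
    refine ⟨i, hi, ?_, ?_⟩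
    · rintro rfl
      omega
    · rw [TrekState.arm_up (H.order i hi) (H.order j hj)]
      simp only [hil, hjl, Bool.false_eq_true, if_false, if_true]
      omega

/-- One round of trekking. -/
def trekStep (v : Trek) (P : Finset ι) (s : ι → TrekState K) (j : ι) : TrekState K :=
  (s j).next v (decide (∃ i ∈ P, i ≠ j ∧ (s i).arm v = (s j).arm v))

lemma UpInv.step_cases {σ : Equiv.Perm (Fin K)} {P : Finset ι} {n : ℕ} {s : ι → TrekState K}
    (H : UpInv σ P n s) {j : ι} (hj : j ∈ P) :
    ((s j).locked = true ∧ (trekStep .up P s j).locked = true ∧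
      ((trekStep .up P s j).rank : ℕ) = (s j).rank) ∨
    ((s j).locked = false ∧ (∃ i ∈ P, (s i).locked = true ∧ ((s i).rank : ℕ) + 1 = (s j).rank) ∧
      (trekStep .up P s j).locked = true ∧ ((trekStep .up P s j).rank : ℕ) = (s j).rank) ∨
    ((s j).locked = false ∧ (∀ i ∈ P, (s i).locked = true → ((s i).rank : ℕ) + 1 ≠ (s j).rank) ∧
      (((s j).count + 1 < (s j).rank ∧ (trekStep .up P s j).locked = false ∧
        ((trekStep .up P s j).rank : ℕ) = (s j).rank ∧
        (trekStep .up P s j).count = (s j).count + 1) ∨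
      ((s j).count + 1 = (s j).rank ∧ ((s j).rank : ℕ) = 1 ∧
        (trekStep .up P s j).locked = true ∧ ((trekStep .up P s j).rank : ℕ) = 0) ∨
      ((s j).count + 1 = (s j).rank ∧ 1 < ((s j).rank : ℕ) ∧
        (trekStep .up P s j).locked = false ∧ ((trekStep .up P s j).rank : ℕ) + 1 = (s j).rank ∧
        (trekStep .up P s j).count = 0))) := by
  unfold trekStep
  cases hl : (s j).locked
  · right
    have hcol := H.collision hj hl
    rcases TrekState.next_up hl (H.count j hj hl)
      (decide (∃ i ∈ P, i ≠ j ∧ (s i).arm .up = (s j).arm .up)) with h | h | h | h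
    · left
      refine ⟨rfl, hcol.1 (of_decide_eq_true h.1), h.2⟩
    all_goals
      right
      have h1 := of_decide_eq_false h.1
      rw [hcol] at h1
      push Not at h1
      refine ⟨rfl, h1, ?_⟩
      tauto
  · left
    rw [TrekState.next_locked hl]
    exact ⟨rfl, hl, rfl⟩

lemma UpInv.step {σ : Equiv.Perm (Fin K)} {P : Finset ι} {n : ℕ} {s : ι → TrekState K}
    (H : UpInv σ P n s) : UpInv σ P (n + 1) (trekStep .up P s) where
  order j hj := by rw [trekStep, TrekState.next_order, H.order j hj]
  count j hj hl := by
    rcases H.step_cases hj with h | h | ⟨h0, -, h | h | h⟩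
    · simp_all
    · simp_all
    · omega
    · simp_all
    · omega
  ahead i hi j hj hij hil hjl := by
    have key : ∀ i ∈ P, (trekStep .up P s i).locked = false → (s i).locked = false ∧
        tri (trekStep .up P s i).rank + (s i).count + 1 =
          tri (s i).rank + (trekStep .up P s i).count ∧
        ((trekStep .up P s i).rank : ℕ) ≤ (s i).rank := by
      intro i hi hil
      rcases H.step_cases hi with h | h | ⟨h0, -, h | h | h⟩
      · simp_all
      · simp_all
      · refine ⟨h0, ?_, ?_⟩ <;> rw [h.2.2.1]
        omega
      · simp_all
      · have h3 := tri_pred (n := (s i).rank) (by omega)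
        rw [show ((s i).rank : ℕ) - 1 = (trekStep .up P s i).rank by omega] at h3
        exact ⟨h0, by omega, by omega⟩
    obtain ⟨h1, h2, h3⟩ := key i hi hil
    obtain ⟨h4, h5, h6⟩ := key j hj hjl
    rcases H.ahead i hi j hj hij h1 h4 with h | h
    · left; omega
    · right; omega
  sep i hi j hj hil hjl := by
    have hij : i ≠ j := by rintro rfl; simp_all
    have hjl0 : (s j).locked = false := by
      rcases H.step_cases hj with h | h | h
      · simp_all
      · simp_all
      · exact h.1
    have hcj := H.count j hj hjl0
    rcases H.step_cases hi with h | ⟨hi0, ⟨k, hk, hkl, hkr⟩, -, h⟩ | ⟨hi0, -, h | h | h⟩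
    · have h1 := H.sep i hi j hj h.1 hjl0
      rcases H.step_cases hj with h' | h' | ⟨-, hno, h' | h' | h'⟩
      · simp_all
      · simp_all
      · omega
      · simp_all
      · have := hno i hi h.1
        omega
    · have hk1 := H.sep k hk j hj hkl hjl0
      have hci := H.count i hi hi0
      rcases H.ahead i hi j hj hij hi0 hjl0 with ha | ha
      · have h2 := H.ahead_lt hi hj hi0 hjl0 ha
        rcases H.step_cases hj with h' | h' | ⟨-, hno, h' | h' | h'⟩
        · simp_all
        · simp_all
        · omega
        · simp_all
        · omega
      · have h2 := H.ahead_lt hj hi hjl0 hi0 ha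
        omega
    · simp_all
    · rcases H.step_cases hj with h' | h' | ⟨-, hno, h' | h' | h'⟩
      · simp_all
      · simp_all
      · omega
      · simp_all
      · omega
    · simp_all
  inj i hi j hj hij hil hjl := by
    wlog hle : (s j).locked = true → (s i).locked = true generalizing i j with W
    · push Not at hle
      exact (W j hj i hi hij.symm hjl hil (fun _ => hle.1)).symm
    rcases H.step_cases hi with h | ⟨hi0, ⟨k, hk, hkl, hkr⟩, -, h⟩ | ⟨hi0, hno, h⟩
    · rcases H.step_cases hj with h' | ⟨hj0, -, -, h'⟩ | ⟨hj0, hno, h' | h' | h'⟩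
      · have := H.inj i hi j hj hij h.1 h'.1
        omega
      · have := H.sep i hi j hj h.1 hj0
        omega
      · simp_all
      · have := H.sep i hi j hj h.1 hj0
        have := hno i hi h.1
        omega
      · simp_all
    · have hj0 : (s j).locked = false := by
        cases hx : (s j).locked
        · rfl
        · rw [hle hx] at hi0; simp at hi0
      have h1 := H.count i hi hi0
      have h2 := H.count j hj hj0
      have h3 : ((s i).rank : ℕ) ≠ (s j).rank := by
        rcases H.ahead i hi j hj hij hi0 hj0 with ha | ha
        · have := H.ahead_lt hi hj hi0 hj0 ha; omega
        · have := H.ahead_lt hj hi hj0 hi0 ha; omega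
      rcases H.step_cases hj with h' | ⟨-, -, -, h'⟩ | ⟨-, hno, h' | h' | h'⟩
      · simp_all
      · omega
      · simp_all
      · have := H.sep k hk j hj hkl hj0
        omega
      · simp_all
    · have hj0 : (s j).locked = false := by
        cases hx : (s j).locked
        · rfl
        · rw [hle hx] at hi0; simp at hi0
      have h1 := H.count i hi hi0
      have h2 := H.count j hj hj0
      have h3 : ((s i).rank : ℕ) ≠ (s j).rank := by
        rcases H.ahead i hi j hj hij hi0 hj0 with ha | ha
        · have := H.ahead_lt hi hj hi0 hj0 ha; omega
        · have := H.ahead_lt hj hi hj0 hi0 ha; omega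
      rcases h with h | h | h
      · simp_all
      · rcases H.step_cases hj with h' | ⟨-, -, -, h'⟩ | ⟨-, hno, h' | h' | h'⟩
        · simp_all
        · omega
        · simp_all
        · omega
        · simp_all
      · simp_all
  pred j hj hl hr := by
    have key : ∀ i ∈ P, (s i).locked = true → ((s i).rank : ℕ) + 1 = (s j).rank →
        ∃ i ∈ P, (trekStep .up P s i).locked = true ∧
          ((trekStep .up P s i).rank : ℕ) + 1 = (s j).rank := by
      intro i hi hil hir
      have : trekStep .up P s i = s i := TrekState.next_locked hil
      exact ⟨i, hi, by rw [this]; exact ⟨hil, hir⟩⟩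
    rcases H.step_cases hj with h | h | ⟨h0, -, h | h | h⟩
    · obtain ⟨i, hi, hil, hir⟩ := H.pred j hj h.1 (by omega)
      rw [h.2.2]
      exact key i hi hil hir
    · obtain ⟨h0, ⟨i, hi, hil, hir⟩, -, h3⟩ := h
      rw [h3]
      exact key i hi hil hir
    · simp_all
    · omega
    · simp_all
  time j hj hl := by
    rcases H.step_cases hj with h | h | ⟨h0, -, h | h | h⟩
    · simp_all
    · simp_all
    · have := H.time j hj h0
      rw [h.2.2.1]
      omega
    · simp_all
    · have := H.time j hj h0
      have h3 := tri_pred (n := (s j).rank) (by omega)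
      rw [show ((s j).rank : ℕ) - 1 = (trekStep .up P s j).rank by omega] at h3
      omega

lemma UpInv.settled {σ : Equiv.Perm (Fin K)} {P : Finset ι} {n : ℕ} {s : ι → TrekState K}
    (H : UpInv σ P n s) (hn : K * K ≤ n) : Settled σ P s := by
  have hl : ∀ j ∈ P, (s j).locked = true := by
    intro j hj
    by_contra hc
    rw [Bool.not_eq_true] at hc
    have h1 := H.time j hj hc
    have h2 := H.count j hj hc
    have h3 := le_tri (s j).rank
    have h4 := tri_le_sq K
    omega
  refine ⟨fun j hj => ⟨hl j hj, H.order j hj⟩, ?_, ?_⟩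
  · intro i hi j hj hij
    by_contra hne
    exact H.inj i hi j hj hne (hl i hi) (hl j hj) (congrArg Fin.val hij)
  · have hclosed : ∀ d : ℕ, ∀ j ∈ P, ∀ m, m + d = (s j).rank → ∃ i ∈ P, ((s i).rank : ℕ) = m := by
      intro d
      induction d with
      | zero => exact fun j hj m hm => ⟨j, hj, by omega⟩
      | succ d ih =>
        intro j hj m hm
        obtain ⟨i, hi, -, hir⟩ := H.pred j hj (hl j hj) (by omega)
        exact ih i hi m (by omega)
    intro j hj
    exact lt_card_of_downward_closed (r := fun j => ((s j).rank : ℕ))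
      (fun j hj m hm => hclosed ((s j).rank - m) j hj m (by omega)) hj

/-! #### Downward trekking -/

/-- Invariant of downward trekking after `n` rounds. -/
structure DownInv (σ : Equiv.Perm (Fin K)) (P : Finset ι) (n : ℕ) (s : ι → TrekState K) :
    Prop where
  order : ∀ j ∈ P, (s j).order = σ
  backoff_le : ∀ j ∈ P, (s j).backoff ≤ K
  backoff_inj : ∀ i ∈ P, ∀ j ∈ P, (s i).backoff = (s j).backoff → i = j
  count : ∀ j ∈ P, (s j).locked = false → (s j).count < (s j).backoff
  time : ∀ j ∈ P, (s j).locked = false → n = (s j).rank * (s j).backoff + (s j).count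
  inj : ∀ i ∈ P, ∀ j ∈ P, i ≠ j → (s i).locked = true → (s j).locked = true →
    ((s i).rank : ℕ) ≠ (s j).rank
  closed : ∀ j ∈ P, ∀ m < ((s j).rank : ℕ), ∃ i ∈ P, ((s i).rank : ℕ) = m

lemma TrekState.next_backoff (v : Trek) (s : TrekState K) (c : Bool) :
    (s.next v c).backoff = s.backoff := by
  unfold TrekState.next
  cases v <;> dsimp only <;> split_ifs <;> rfl

lemma TrekState.next_down {s : TrekState K} (h : s.locked = false) (hc : s.count < s.backoff)
    (c : Bool) :
    (c = false ∧ (s.next .down c).locked = true ∧ ((s.next .down c).rank : ℕ) = s.rank) ∨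
    (c = true ∧ s.count + 1 < s.backoff ∧ (s.next .down c).locked = false ∧
      ((s.next .down c).rank : ℕ) = s.rank ∧ (s.next .down c).count = s.count + 1) ∨
    (c = true ∧ s.count + 1 = s.backoff ∧ (s.rank : ℕ) + 1 < K ∧ (s.next .down c).locked = false ∧
      ((s.next .down c).rank : ℕ) = s.rank + 1 ∧ (s.next .down c).count = 0) ∨
    (c = true ∧ (s.rank : ℕ) + 1 = K) := by
  unfold TrekState.next
  rw [if_neg (by simp [h])]
  dsimp only
  have hr := s.rank.2
  cases c
  · simp
  · by_cases h1 : s.count + 1 < s.backoff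
    · simp [h1, h]
    · by_cases h2 : (s.rank : ℕ) + 1 < K
      · simp [h1, h2, h]; omega
      · simp [h1, h2]; omega

lemma DownInv.step_cases {σ : Equiv.Perm (Fin K)} {P : Finset ι} {n : ℕ} {s : ι → TrekState K}
    (H : DownInv σ P n s) (hP : P.card ≤ K) {j : ι} (hj : j ∈ P) :
    ((s j).locked = true ∧ (trekStep .down P s j).locked = true ∧
      ((trekStep .down P s j).rank : ℕ) = (s j).rank) ∨
    ((s j).locked = false ∧ (∀ i ∈ P, i ≠ j → ((s i).rank : ℕ) ≠ (s j).rank) ∧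
      (trekStep .down P s j).locked = true ∧ ((trekStep .down P s j).rank : ℕ) = (s j).rank) ∨
    ((s j).locked = false ∧ (∃ i ∈ P, i ≠ j ∧ ((s i).rank : ℕ) = (s j).rank) ∧
      (((s j).count + 1 < (s j).backoff ∧ (trekStep .down P s j).locked = false ∧
        ((trekStep .down P s j).rank : ℕ) = (s j).rank ∧
        (trekStep .down P s j).count = (s j).count + 1) ∨
      ((s j).count + 1 = (s j).backoff ∧ ((s j).rank : ℕ) + 1 < K ∧
        (trekStep .down P s j).locked = false ∧
        ((trekStep .down P s j).rank : ℕ) = (s j).rank + 1 ∧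
        (trekStep .down P s j).count = 0))) := by
  have harm : ∀ i ∈ P, (s i).arm .down = (s j).arm .down ↔ ((s i).rank : ℕ) = (s j).rank := by
    intro i hi
    simp [TrekState.arm, H.order i hi, H.order j hj, Fin.ext_iff]
  unfold trekStep
  cases hl : (s j).locked
  · right
    rcases TrekState.next_down hl (H.count j hj hl)
      (decide (∃ i ∈ P, i ≠ j ∧ (s i).arm .down = (s j).arm .down)) with h | h | h | h
    · left
      have h1 := of_decide_eq_false h.1
      push Not at h1
      exact ⟨rfl, fun i hi hij => (harm i hi).not.1 (h1 i hi hij), h.2⟩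
    · obtain ⟨i, hi, hij, ha⟩ := of_decide_eq_true h.1
      exact .inr ⟨rfl, ⟨i, hi, hij, (harm i hi).1 ha⟩, .inl h.2⟩
    · obtain ⟨i, hi, hij, ha⟩ := of_decide_eq_true h.1
      exact .inr ⟨rfl, ⟨i, hi, hij, (harm i hi).1 ha⟩, .inr h.2⟩
    · exfalso
      obtain ⟨i, hi, hij, ha⟩ := of_decide_eq_true h.1
      have hir := (harm i hi).1 ha
      have hsub : Finset.range K ⊆ (P.erase i).image (fun j => ((s j).rank : ℕ)) := by
        intro m hm
        rw [Finset.mem_range] at hm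
        by_cases hmr : m = (s j).rank
        · exact Finset.mem_image.2 ⟨j, Finset.mem_erase.2 ⟨hij.symm, hj⟩, hmr.symm⟩
        · obtain ⟨k, hk, hkr⟩ := H.closed j hj m (by omega)
          refine Finset.mem_image.2 ⟨k, Finset.mem_erase.2 ⟨?_, hk⟩, hkr⟩
          rintro rfl
          omega
      have h1 := (Finset.card_le_card hsub).trans Finset.card_image_le
      rw [Finset.card_range, Finset.card_erase_of_mem hi] at h1
      have := (s i).rank.2
      omega
  · left
    rw [TrekState.next_locked hl]
    exact ⟨rfl, hl, rfl⟩

lemma DownInv.step {σ : Equiv.Perm (Fin K)} {P : Finset ι} {n : ℕ} {s : ι → TrekState K}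
    (H : DownInv σ P n s) (hP : P.card ≤ K) : DownInv σ P (n + 1) (trekStep .down P s) := by
  have hb : ∀ j, (trekStep .down P s j).backoff = (s j).backoff :=
    fun j => TrekState.next_backoff _ _ _
  have stay : ∀ j ∈ P, ∃ i ∈ P, ((trekStep .down P s i).rank : ℕ) = (s j).rank := by
    intro j hj
    rcases H.step_cases hP hj with h | h | ⟨h0, ⟨i, hi, hij, hir⟩, h | h⟩
    · exact ⟨j, hj, h.2.2⟩
    · exact ⟨j, hj, h.2.2.2⟩
    · exact ⟨j, hj, h.2.2.1⟩
    · refine ⟨i, hi, ?_⟩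
      rw [← hir]
      rcases H.step_cases hP hi with h' | h' | ⟨h0', -, h' | h'⟩
      · exact h'.2.2
      · exact h'.2.2.2
      · exact h'.2.2.1
      · exfalso
        have h1 := H.time j hj h0
        have h2 := H.time i hi h0'
        rw [hir] at h2
        have h3 : (((s j).rank : ℕ) + 1) * (s i).backoff = ((s j).rank + 1) * (s j).backoff := by
          rw [add_mul, add_mul]; omega
        exact hij (H.backoff_inj i hi j hj (Nat.eq_of_mul_eq_mul_left (Nat.succ_pos _) h3))
  refine ⟨fun j hj => ?_, fun j hj => ?_, fun i hi j hj => ?_, fun j hj hl => ?_,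
    fun j hj hl => ?_, fun i hi j hj hij hil hjl => ?_, fun j hj m hm => ?_⟩
  · rw [trekStep, TrekState.next_order, H.order j hj]
  · rw [hb]; exact H.backoff_le j hj
  · rw [hb, hb]; exact H.backoff_inj i hi j hj
  · rw [hb]
    rcases H.step_cases hP hj with h | h | ⟨h0, -, h | h⟩
    · simp_all
    · simp_all
    · omega
    · omega
  · rw [hb]
    rcases H.step_cases hP hj with h | h | ⟨h0, -, h | h⟩
    · simp_all
    · simp_all
    · have := H.time j hj h0
      rw [h.2.2.1]
      omega
    · have := H.time j hj h0
      rw [h.2.2.2.1, add_mul]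
      omega
  · rcases H.step_cases hP hi with h | ⟨h1, h2, h3, h4⟩ | ⟨h0, -, h | h⟩
    · rcases H.step_cases hP hj with h' | ⟨h1', h2', h3', h4'⟩ | ⟨h0, -, h' | h'⟩
      · have := H.inj i hi j hj hij h.1 h'.1
        omega
      · have := h2' i hi hij
        omega
      · simp_all
      · simp_all
    · rcases H.step_cases hP hj with h' | ⟨h1', h2', h3', h4'⟩ | ⟨h0, -, h' | h'⟩
      · have := h2 j hj hij.symm
        omega
      · have := h2 j hj hij.symm
        omega
      · simp_all
      · simp_all
    · simp_all
    · simp_all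
  · rcases Nat.lt_or_ge m (s j).rank with h | h
    · obtain ⟨k, hk, hkr⟩ := H.closed j hj m h
      rw [← hkr]
      exact stay k hk
    · rcases H.step_cases hP hj with h' | h' | ⟨h0, -, h' | h'⟩
      · omega
      · omega
      · omega
      · have : m = (s j).rank := by omega
        rw [this]
        exact stay j hj

lemma DownInv.settled {σ : Equiv.Perm (Fin K)} {P : Finset ι} {n : ℕ} {s : ι → TrekState K}
    (H : DownInv σ P n s) (hn : K * K ≤ n) : Settled σ P s := by
  have hl : ∀ j ∈ P, (s j).locked = true := by
    intro j hj
    by_contra hc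
    rw [Bool.not_eq_true] at hc
    have h1 := H.time j hj hc
    have h2 := H.count j hj hc
    have h3 := H.backoff_le j hj
    have h4 : (((s j).rank : ℕ) + 1) * (s j).backoff ≤ K * K :=
      Nat.mul_le_mul (s j).rank.2 h3
    rw [add_mul] at h4
    omega
  refine ⟨fun j hj => ⟨hl j hj, H.order j hj⟩, ?_, ?_⟩
  · intro i hi j hj hij
    by_contra hne
    exact H.inj i hi j hj hne (hl i hi) (hl j hj) (congrArg Fin.val hij)
  · intro j hj
    exact lt_card_of_downward_closed (r := fun j => ((s j).rank : ℕ)) H.closed hj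

/-- If all players have the same ranking and their last arms are distinct, then after `K²` rounds
of trekking they are locked on the best arms. -/
lemma settled_trekRun [NeZero K] (v : Trek) {P : Finset ι} (hP : P.card ≤ K)
    {σ : Equiv.Perm (Fin K)} {l : ι → LearnState K} (hσ : ∀ j ∈ P, (l j).ranking = σ)
    (hinj : Set.InjOn (fun j => (l j).last) (P : Set ι)) {n : ℕ} (hn : K * K ≤ n) :
    Settled σ P (trekRun v P (fun j => TrekState.init v (l j)) n) := by
  have hne : ∀ i ∈ P, ∀ j ∈ P, i ≠ j →
      ((σ.symm (l i).last : Fin K) : ℕ) ≠ (σ.symm (l j).last : Fin K) := by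
    intro i hi j hj hij h
    exact hij (hinj hi hj (σ.symm.injective (Fin.ext h)))
  cases v with
  | up =>
    have hr : ∀ j ∈ P, ((TrekState.init .up (l j)).rank : ℕ) = (σ.symm (l j).last : Fin K) := by
      intro j hj; simp [TrekState.init, hσ j hj]
    have hlk : ∀ j ∈ P, (TrekState.init .up (l j)).locked =
        decide (((σ.symm (l j).last : Fin K) : ℕ) = 0) := by
      intro j hj; simp [TrekState.init, hσ j hj]
    have hcount : ∀ j, (TrekState.init .up (l j)).count = 0 := fun j => rfl
    have h0 : UpInv σ P 0 (fun j => TrekState.init .up (l j)) := by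
      refine ⟨fun j hj => by simp [TrekState.init, hσ j hj], fun j hj hl => ?_,
        fun i hi j hj hij hil hjl => ?_, fun i hi j hj hil hjl => ?_,
        fun i hi j hj hij hil hjl => ?_, fun j hj hl hpos => ?_, fun j hj hl => ?_⟩
      · rw [hlk j hj, decide_eq_false_iff_not] at hl
        rw [hr j hj, hcount]; omega
      · rw [hlk i hi, decide_eq_false_iff_not] at hil
        rw [hlk j hj, decide_eq_false_iff_not] at hjl
        simp only [hr i hi, hr j hj, hcount]
        have h1 := hne i hi j hj hij
        have h2 := tri_pred (n := (σ.symm (l i).last : Fin K)) (by omega)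
        have h3 := tri_pred (n := (σ.symm (l j).last : Fin K)) (by omega)
        rcases Nat.lt_or_gt_of_ne h1 with h | h
        · have := tri_mono (show ((σ.symm (l i).last : Fin K) : ℕ) ≤
            (σ.symm (l j).last : Fin K) - 1 by omega)
          omega
        · have := tri_mono (show ((σ.symm (l j).last : Fin K) : ℕ) ≤
            (σ.symm (l i).last : Fin K) - 1 by omega)
          omega
      · rw [hlk i hi, decide_eq_true_eq] at hil
        rw [hlk j hj, decide_eq_false_iff_not] at hjl
        simp only [hr i hi, hr j hj]
        omega
      · rw [hlk i hi, decide_eq_true_eq] at hil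
        rw [hlk j hj, decide_eq_true_eq] at hjl
        have := hne i hi j hj hij
        omega
      · rw [hlk j hj, decide_eq_true_eq] at hl
        rw [hr j hj] at hpos
        omega
      · have := tri_mono (TrekState.init .up (l j)).rank.2.le
        simp only [hcount]
        omega
    have hall : ∀ n, UpInv σ P n (trekRun .up P (fun j => TrekState.init .up (l j)) n) := by
      intro n
      induction n with
      | zero => exact h0
      | succ n ih => exact ih.step
    exact (hall n).settled hn
  | down =>
    have hlk : ∀ j ∈ P, (TrekState.init .down (l j)).locked =
        decide (((σ.symm (l j).last : Fin K) : ℕ) = 0) := by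
      intro j hj; simp [TrekState.init, hσ j hj]
    have hb : ∀ j ∈ P, (TrekState.init .down (l j)).backoff =
        K - ((σ.symm (l j).last : Fin K) : ℕ) := by
      intro j hj; simp [TrekState.init, hσ j hj]
    have hcount : ∀ j, (TrekState.init .down (l j)).count = 0 := fun j => rfl
    have hr : ∀ j, ((TrekState.init .down (l j)).rank : ℕ) = 0 := fun j => rfl
    have h0 : DownInv σ P 0 (fun j => TrekState.init .down (l j)) := by
      refine ⟨fun j hj => by simp [TrekState.init, hσ j hj], fun j hj => ?_,
        fun i hi j hj h => ?_, fun j hj hl => ?_, fun j hj hl => ?_,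
        fun i hi j hj hij hil hjl => ?_, fun j hj m hm => ?_⟩
      · rw [hb j hj]; omega
      · by_contra hij
        rw [hb i hi, hb j hj] at h
        have := hne i hi j hj hij
        have h1 := (σ.symm (l i).last : Fin K).2
        have h2 := (σ.symm (l j).last : Fin K).2
        omega
      · have h1 := (σ.symm (l j).last : Fin K).2
        rw [hb j hj, hcount]
        omega
      · simp only [hr, hcount]; omega
      · rw [hlk i hi, decide_eq_true_eq] at hil
        rw [hlk j hj, decide_eq_true_eq] at hjl
        have := hne i hi j hj hij
        omega
      · rw [hr] at hm
        omega
    have hall : ∀ n, DownInv σ P n (trekRun .down P (fun j => TrekState.init .down (l j)) n) := by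
      intro n
      induction n with
      | zero => exact h0
      | succ n ih => exact ih.step hP
    exact (hall n).settled hn

end Trekking

/-! ### The learning phase among a fixed set of players -/

section Learning

variable {ι : Type*} [DecidableEq ι] {K : ℕ} [NeZero K]

/-- One round of the learning phase of the players `P`, with draws `u` and rewards `y`. -/
noncomputable def learnStep (P : Finset ι) (u : ι → Fin K) (y : ι → Fin K → ℝ)
    (l : ι → LearnState K) (j : ι) : LearnState K :=
  (l j).next ((l j).arm (u j))
    (decide (∃ i ∈ P, i ≠ j ∧ (l i).arm (u i) = (l j).arm (u j))) (y j ((l j).arm (u j)))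

/-- The learning phase of the players `P`. -/
noncomputable def learnRun (P : Finset ι) (u : ℕ → ι → Fin K) (y : ℕ → ι → Fin K → ℝ) :
    ℕ → ι → LearnState K
  | 0 => fun _ => LearnState.init K
  | n + 1 => learnStep P (u n) (y n) (learnRun P u y n)

/-- The arm of a player with indicator `c.1` and last arm `c.2`. -/
def seatArm (c : Bool × Fin K) (u : Fin K) : Fin K := if c.1 then c.2 + 1 else u

/-- One round of the process that keeps only the indicator `L` and the last arm of each player. -/
def chairStep (P : Finset ι) (u : ι → Fin K) (c : ι → Bool × Fin K) (j : ι) : Bool × Fin K :=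
  ((c j).1 || !decide (∃ i ∈ P, i ≠ j ∧ seatArm (c i) (u i) = seatArm (c j) (u j)),
    seatArm (c j) (u j))

/-- The indicators `L` and the last arms of the players in the learning phase. -/
def chairs (P : Finset ι) (u : ℕ → ι → Fin K) : ℕ → ι → Bool × Fin K
  | 0 => fun _ => (false, 0)
  | n + 1 => chairStep P (u n) (chairs P u n)

lemma chairs_learnRun (P : Finset ι) (u : ℕ → ι → Fin K) (y : ℕ → ι → Fin K → ℝ) (n : ℕ) :
    chairs P u n = fun j => ((learnRun P u y n j).L, (learnRun P u y n j).last) := by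
  induction n with
  | zero => rfl
  | succ n ih => rw [chairs, ih]; rfl

lemma chairs_congr (P : Finset ι) {u u' : ℕ → ι → Fin K} {n : ℕ} (h : ∀ m < n, u m = u' m) :
    chairs P u n = chairs P u' n := by
  induction n with
  | zero => rfl
  | succ n ih => rw [chairs, chairs, ih fun m hm => h m (hm.trans n.lt_succ_self),
      h n n.lt_succ_self]

/-- Players whose indicator is set sit on distinct arms. -/
def Seated (P : Finset ι) (c : ι → Bool × Fin K) : Prop :=
  ∀ i ∈ P, ∀ j ∈ P, i ≠ j → (c i).1 = true → (c j).1 = true → (c i).2 ≠ (c j).2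

lemma Seated.step {P : Finset ι} {c : ι → Bool × Fin K} (H : Seated P c) (u : ι → Fin K) :
    Seated P (chairStep P u c) := by
  intro i hi j hj hij hli hlj heq
  simp only [chairStep, Bool.or_eq_true, Bool.not_eq_true', decide_eq_false_iff_not] at hli hlj heq
  rcases hli with hli | hli
  · rcases hlj with hlj | hlj
    · simp only [seatArm, hli, hlj, if_true] at heq
      exact H i hi j hj hij hli hlj (add_right_cancel heq)
    · exact hlj ⟨i, hi, hij, heq⟩
  · exact hli ⟨j, hj, hij.symm, heq.symm⟩

lemma seated_chairs (P : Finset ι) (u : ℕ → ι → Fin K) (n : ℕ) : Seated P (chairs P u n) := by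
  induction n with
  | zero => intro i _ j _ _ h; simp [chairs] at h
  | succ n ih => exact ih.step _

/-- The arm reached from `a` by `d` sequential steps. -/
def rot (a : Fin K) (d : ℕ) : Fin K := (fun x => x + 1)^[d] a

lemma rot_succ (a : Fin K) (d : ℕ) : rot a (d + 1) = rot a d + 1 :=
  Function.iterate_succ_apply' _ _ _

lemma rot_val (a : Fin K) (d : ℕ) : (rot a d : ℕ) = (a + d) % K := by
  induction d with
  | zero => simp [rot, Nat.mod_eq_of_lt a.2]
  | succ d ih => rw [rot_succ, Fin.val_add, ih, Fin.val_one', ← Nat.add_mod, add_assoc]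

/-- The rounds in `[τ, n)` in which a player who sits on arm `a` after `τ` rounds and moves
sequentially plays arm `k`. -/
def tailSet (τ n : ℕ) (a k : Fin K) : Finset ℕ :=
  (Finset.Ico τ n).filter (fun t => rot a (t - τ + 1) = k)

lemma div_le_card_tailSet (τ n : ℕ) (a k : Fin K) : (n - τ) / K ≤ (tailSet τ n a k).card := by
  have hK : 0 < K := Nat.pos_of_ne_zero (NeZero.ne K)
  have hk := k.2
  have ha := a.2
  obtain ⟨r, hr, hrk⟩ : ∃ r < K, (a + (r + 1)) % K = k := by
    rcases Nat.lt_or_ge (a : ℕ) k with h | h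
    · exact ⟨k - a - 1, by omega, by rw [Nat.mod_eq_of_lt (by omega)]; omega⟩
    · refine ⟨K + k - a - 1, by omega, ?_⟩
      rw [show (a : ℕ) + (K + k - a - 1 + 1) = k + K by omega, Nat.add_mod_right,
        Nat.mod_eq_of_lt hk]
  have hsub : (Finset.range ((n - τ) / K)).image (fun m => τ + m * K + r) ⊆ tailSet τ n a k := by
    intro t ht
    obtain ⟨m, hm, rfl⟩ := Finset.mem_image.1 ht
    rw [Finset.mem_range] at hm
    have h1 : (m + 1) * K ≤ n - τ := (Nat.le_div_iff_mul_le hK).1 hm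
    rw [add_mul, one_mul] at h1
    refine Finset.mem_filter.2 ⟨Finset.mem_Ico.2 ⟨by omega, by omega⟩, ?_⟩
    apply Fin.ext
    rw [rot_val, ← hrk, show (a : ℕ) + (τ + m * K + r - τ + 1) = a + (r + 1) + m * K by omega,
      Nat.add_mul_mod_self_right]
  have h2 := Finset.card_le_card hsub
  rwa [Finset.card_image_of_injective _ ?_, Finset.card_range] at h2
  intro m m' h
  have h3 : m * K = m' * K := by simpa using h
  exact Nat.eq_of_mul_eq_mul_right hK h3

lemma tailSet_self (τ : ℕ) (a k : Fin K) : tailSet τ τ a k = ∅ := by simp [tailSet]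

lemma tailSet_succ {τ n : ℕ} (h : τ ≤ n) (a k : Fin K) :
    tailSet τ (n + 1) a k =
      if rot a (n - τ + 1) = k then insert n (tailSet τ n a k) else tailSet τ n a k := by
  rw [tailSet, ← Finset.insert_Ico_right_eq_Ico_add_one h, Finset.filter_insert]
  rfl

lemma notMem_tailSet {τ n : ℕ} (a k : Fin K) : n ∉ tailSet τ n a k := by simp [tailSet]

/-- Once the indicators of all players are set, they move sequentially. -/
lemma chairs_of_fixed {P : Finset ι} {u : ℕ → ι → Fin K} {τ : ℕ}
    (h : ∀ j ∈ P, (chairs P u τ j).1 = true) (d : ℕ) :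
    ∀ j ∈ P, chairs P u (τ + d) j = (true, rot (chairs P u τ j).2 d) := by
  induction d with
  | zero => intro j hj; exact Prod.ext (h j hj) rfl
  | succ d ih =>
    intro j hj
    rw [← add_assoc, chairs, chairStep, ih j hj, rot_succ]
    simp [seatArm]

lemma learnRun_succ_of_fixed {P : Finset ι} {u : ℕ → ι → Fin K} {y : ℕ → ι → Fin K → ℝ} {τ : ℕ}
    (h : ∀ j ∈ P, (chairs P u τ j).1 = true) {n : ℕ} (hn : τ ≤ n) {j : ι} (hj : j ∈ P) :
    learnRun P u y (n + 1) j = (learnRun P u y n j).next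
      (rot (chairs P u τ j).2 (n - τ + 1)) false (y n j (rot (chairs P u τ j).2 (n - τ + 1))) := by
  obtain ⟨d, rfl⟩ := Nat.exists_eq_add_of_le hn
  have harm : ∀ i ∈ P, (learnRun P u y (τ + d) i).arm (u (τ + d) i) =
      rot (chairs P u τ i).2 (d + 1) := by
    intro i hi
    have h1 := chairs_of_fixed h d i hi
    rw [chairs_learnRun P u y (τ + d)] at h1
    simp only [Prod.mk.injEq] at h1
    rw [LearnState.arm, h1.1, h1.2, rot_succ]
    simp
  have hfree : ¬ ∃ i ∈ P, i ≠ j ∧ (learnRun P u y (τ + d) i).arm (u (τ + d) i) =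
      (learnRun P u y (τ + d) j).arm (u (τ + d) j) := by
    rintro ⟨i, hi, hij, he⟩
    rw [harm i hi, harm j hj] at he
    refine seated_chairs P u (τ + (d + 1)) i hi j hj hij ?_ ?_ ?_
    · rw [chairs_of_fixed h _ i hi]
    · rw [chairs_of_fixed h _ j hj]
    · rw [chairs_of_fixed h _ i hi, chairs_of_fixed h _ j hj]
      exact he
  rw [learnRun, learnStep, decide_eq_false hfree, harm j hj, Nat.add_sub_cancel_left]

lemma learnRun_stats_of_fixed {P : Finset ι} {u : ℕ → ι → Fin K} {y : ℕ → ι → Fin K → ℝ} {τ : ℕ}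
    (h : ∀ j ∈ P, (chairs P u τ j).1 = true) {n : ℕ} (hn : τ ≤ n) {j : ι} (hj : j ∈ P)
    (k : Fin K) :
    (learnRun P u y n j).V k = (learnRun P u y τ j).V k +
        ∑ t ∈ tailSet τ n (chairs P u τ j).2 k, y t j k ∧
      (learnRun P u y n j).S k = (learnRun P u y τ j).S k +
        (tailSet τ n (chairs P u τ j).2 k).card := by
  induction n, hn using Nat.le_induction with
  | base => simp [tailSet_self]
  | succ n hn ih =>
    rw [learnRun_succ_of_fixed h hn hj, tailSet_succ hn]
    simp only [LearnState.next, Bool.false_eq_true, if_false]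
    split_ifs with hr
    · subst hr
      rw [Function.update_self, Function.update_self, Finset.sum_insert (notMem_tailSet _ _),
        Finset.card_insert_of_notMem (notMem_tailSet _ _), ih.1, ih.2]
      exact ⟨by ring, by ring⟩
    · rw [Function.update_of_ne (Ne.symm hr), Function.update_of_ne (Ne.symm hr)]
      exact ih

lemma learnRun_bounds {P : Finset ι} {u : ℕ → ι → Fin K} {y : ℕ → ι → Fin K → ℝ} {n : ℕ} {j : ι}
    (hy : ∀ t < n, ∀ k, y t j k ∈ Set.Icc (0 : ℝ) 1) :
    (∀ k, 0 ≤ (learnRun P u y n j).V k ∧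
      (learnRun P u y n j).V k ≤ (learnRun P u y n j).S k) ∧
    ∑ k, (learnRun P u y n j).S k = n := by
  induction n with
  | zero => simp [learnRun, LearnState.init]
  | succ n ih =>
    obtain ⟨h1, h2⟩ := ih fun t ht => hy t (ht.trans n.lt_succ_self)
    rw [learnRun, learnStep]
    set l := learnRun P u y n j
    set a := l.arm (u n j)
    have hya := hy n n.lt_succ_self a
    generalize decide (∃ i ∈ P, i ≠ j ∧ (learnRun P u y n i).arm (u n i) = a) = c
    constructor
    · intro k
      have hk := h1 k
      simp only [LearnState.next]
      by_cases hka : k = a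
      · subst hka
        cases c
        · simp only [Bool.false_eq_true, if_false, Function.update_self, Nat.cast_add,
            Nat.cast_one]
          exact ⟨add_nonneg hk.1 hya.1, add_le_add hk.2 hya.2⟩
        · simp only [if_true, Function.update_self, Nat.cast_add, Nat.cast_one]
          exact ⟨hk.1, by linarith [hk.2]⟩
      · cases c <;> simp [Function.update_of_ne hka, hk]
    · simp only [LearnState.next]
      rw [Finset.sum_update_of_mem (Finset.mem_univ a), ← h2,
        ← Finset.add_sum_erase Finset.univ l.S (Finset.mem_univ a), Finset.sdiff_singleton_eq_erase]
      ring

/-- Empirical means of contaminated samples: `a` of the plays are arbitrary, the other `n` are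
accurate up to `θ`. -/
lemma contaminated_lt {μ₁ μ₂ ε θ n₀ n₁ n₂ a₁ a₂ V₁ V₂ Z₁ Z₂ : ℝ} (hgap : μ₂ + ε < μ₁)
    (hμ₁ : μ₁ ≤ 1) (hμ₂ : 0 ≤ μ₂) (hθ : 0 ≤ θ) (hn₀ : 0 < n₀) (hn₁ : n₀ ≤ n₁) (hn₂ : n₀ ≤ n₂)
    (ha₁ : 0 ≤ a₁) (ha₂ : 0 ≤ a₂) (hV₁ : 0 ≤ V₁) (hV₂ : V₂ ≤ a₂)
    (hZ₁ : n₁ * μ₁ - n₁ * θ ≤ Z₁) (hZ₂ : Z₂ ≤ n₂ * μ₂ + n₂ * θ)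
    (hε : (a₁ + a₂) / n₀ + 2 * θ ≤ ε) :
    (V₂ + Z₂) / (a₂ + n₂) < (V₁ + Z₁) / (a₁ + n₁) := by
  have h1 : μ₁ - θ - a₁ / n₀ ≤ (V₁ + Z₁) / (a₁ + n₁) := by
    rw [le_div_iff₀ (by linarith)]
    have hq : a₁ ≤ a₁ / n₀ * (a₁ + n₁) := by
      rw [div_mul_eq_mul_div, le_div_iff₀ hn₀]
      nlinarith
    nlinarith
  have h2 : (V₂ + Z₂) / (a₂ + n₂) ≤ μ₂ + θ + a₂ / n₀ := by
    rw [div_le_iff₀ (by linarith)]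
    have hq : a₂ ≤ a₂ / n₀ * (a₂ + n₂) := by
      rw [div_mul_eq_mul_div, le_div_iff₀ hn₀]
      nlinarith
    have : 0 ≤ (μ₂ + θ) * a₂ := by positivity
    nlinarith
  rw [add_div] at hε
  linarith

/-- The draws `u` and the rewards `y` of an epoch are good for the players `P`: everybody has had a
collision-free play within `τ` rounds, and all empirical means over the rounds `[τ, T₀)` are
accurate up to `θ`. -/
structure GoodEpoch (P : Finset ι) (μ : Fin K → ℝ) (τ T₀ : ℕ) (θ : ℝ) (u : ℕ → ι → Fin K)
    (y : ℕ → ι → Fin K → ℝ) : Prop where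
  fixed : ∀ j ∈ P, (chairs P u τ j).1 = true
  accurate : ∀ j ∈ P, ∀ a k, |∑ t ∈ tailSet τ T₀ a k, y t j k - (tailSet τ T₀ a k).card * μ k| ≤
    (tailSet τ T₀ a k).card * θ

/-- In a good epoch every player ranks the arms correctly. -/
lemma GoodEpoch.ranking_eq {P : Finset ι} {μ : Fin K → ℝ} {τ T₀ : ℕ} {θ ε n₀ : ℝ}
    {u : ℕ → ι → Fin K} {y : ℕ → ι → Fin K → ℝ} (H : GoodEpoch P μ τ T₀ θ u y)
    (hμ : ∀ k, μ k ∈ Set.Icc (0 : ℝ) 1) (hgap : ∀ i k, i ≠ k → ε < |μ i - μ k|)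
    (hθ : 0 ≤ θ) (hn₀ : 0 < n₀) (hτ : τ ≤ T₀) (hn : n₀ ≤ ((T₀ - τ) / K : ℕ))
    (hε : τ / n₀ + 2 * θ ≤ ε) {j : ι} (hj : j ∈ P)
    (hy : ∀ t < τ, ∀ k, y t j k ∈ Set.Icc (0 : ℝ) 1) :
    (learnRun P u y T₀ j).ranking = Tuple.sort (fun k => -μ k) := by
  have hb := learnRun_bounds (P := P) (u := u) hy
  set f : Fin K → ℝ := fun k => -((learnRun P u y T₀ j).V k / ((learnRun P u y T₀ j).S k : ℝ))
  have hlt : ∀ i k, μ k < μ i → f i < f k := by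
    intro i k hik
    have hne : i ≠ k := by rintro rfl; exact lt_irrefl _ hik
    have hg := hgap i k hne
    rw [abs_of_pos (by linarith)] at hg
    have hi := learnRun_stats_of_fixed (y := y) H.fixed hτ hj i
    have hk := learnRun_stats_of_fixed (y := y) H.fixed hτ hj k
    have hai := abs_le.1 (H.accurate j hj (chairs P u τ j).2 i)
    have hak := abs_le.1 (H.accurate j hj (chairs P u τ j).2 k)
    have hni : n₀ ≤ ((tailSet τ T₀ (chairs P u τ j).2 i).card : ℝ) :=
      hn.trans (by exact_mod_cast div_le_card_tailSet _ _ _ _)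
    have hnk : n₀ ≤ ((tailSet τ T₀ (chairs P u τ j).2 k).card : ℝ) :=
      hn.trans (by exact_mod_cast div_le_card_tailSet _ _ _ _)
    have hsum : ((learnRun P u y τ j).S i : ℝ) + (learnRun P u y τ j).S k ≤ τ := by
      have h1 : (learnRun P u y τ j).S i + (learnRun P u y τ j).S k ≤ τ := by
        rw [← Finset.sum_pair hne (f := (learnRun P u y τ j).S)]
        exact (Finset.sum_le_sum_of_subset (Finset.subset_univ _)).trans_eq hb.2
      exact_mod_cast h1
    simp only [f, neg_lt_neg_iff]
    rw [hi.1, hi.2, hk.1, hk.2, Nat.cast_add, Nat.cast_add]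
    refine contaminated_lt (μ₁ := μ i) (μ₂ := μ k) (ε := ε) (θ := θ) (n₀ := n₀) (by linarith)
      (hμ i).2 (hμ k).1 hθ hn₀ hni hnk (Nat.cast_nonneg _) (Nat.cast_nonneg _) (hb.1 i).1
      (hb.1 k).2 (by linarith) (by linarith) ?_
    refine le_trans ?_ hε
    gcongr
  change Tuple.sort f = _
  have hinj : ∀ i k, μ i = μ k → i = k := by
    intro i k h
    by_contra hne
    have := hgap i k hne
    have h0 : 0 ≤ τ / n₀ := by positivity
    rw [h, sub_self, abs_zero] at this
    linarith
  have hσ : StrictMono ((fun k => -μ k) ∘ Tuple.sort (fun k => -μ k)) := by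
    refine (Tuple.monotone_sort _).strictMono_of_injective ?_
    intro i k h
    exact (Tuple.sort (fun k => -μ k)).injective (hinj _ _ (neg_injective h))
  have hmono : StrictMono (f ∘ Tuple.sort (fun k => -μ k)) := by
    intro i k hik
    have := hσ hik
    exact hlt _ _ (by simpa using this)
  refine (Tuple.eq_sort_iff.2 ⟨hmono.monotone, fun i k hik h => ?_⟩).symm
  exact absurd h (hmono hik).ne

lemma GoodEpoch.last_injOn {P : Finset ι} {μ : Fin K → ℝ} {τ T₀ : ℕ} {θ : ℝ}
    {u : ℕ → ι → Fin K} {y : ℕ → ι → Fin K → ℝ} (H : GoodEpoch P μ τ T₀ θ u y) (hτ : τ ≤ T₀) :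
    Set.InjOn (fun j => (learnRun P u y T₀ j).last) (P : Set ι) := by
  intro i hi j hj hij
  by_contra hne
  obtain ⟨d, rfl⟩ := Nat.exists_eq_add_of_le hτ
  have hs := seated_chairs P u (τ + d) i hi j hj hne
    (by rw [chairs_of_fixed H.fixed _ i hi]) (by rw [chairs_of_fixed H.fixed _ j hj])
  rw [chairs_learnRun P u y] at hs
  exact hs hij

end Learning

/-! ### Undisturbed epochs -/

section Epoch

variable {ι : Type*} [Fintype ι] [DecidableEq ι] {K : ℕ} [NeZero K]

omit [NeZero K] in
lemma sort_neg_lt_iff {μ : Fin K → ℝ} (hμ : Function.Injective μ) (i k : Fin K) :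
    (Tuple.sort (fun k => -μ k)).symm i < (Tuple.sort (fun k => -μ k)).symm k ↔ μ k < μ i := by
  have hσ : StrictMono ((fun k => -μ k) ∘ Tuple.sort (fun k => -μ k)) := by
    refine (Tuple.monotone_sort _).strictMono_of_injective ?_
    intro i k h
    exact (Tuple.sort (fun k => -μ k)).injective (hμ (neg_injective h))
  rw [← hσ.lt_iff_lt]
  simp

omit [NeZero K] in
lemma mem_topArms_iff {μ : Fin K → ℝ} (hμ : Function.Injective μ) (n : ℕ) (k : Fin K) :
    k ∈ topArms μ n ↔ ((Tuple.sort (fun k => -μ k)).symm k : ℕ) < n := by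
  set σ := Tuple.sort (fun k => -μ k)
  have h : Finset.univ.filter (fun i => μ k < μ i) = (Finset.Iio (σ.symm k)).image σ := by
    ext i
    rw [Finset.mem_filter, ← sort_neg_lt_iff hμ, Finset.mem_image]
    simp only [Finset.mem_univ, true_and, Finset.mem_Iio]
    constructor
    · exact fun h => ⟨_, h, by simp [σ]⟩
    · rintro ⟨r, hr, rfl⟩
      simpa [σ] using hr
  rw [topArms, Finset.mem_filter, h, Finset.card_image_of_injective _ σ.injective, Fin.card_Iio]
  simp

omit [Fintype ι] [DecidableEq ι] [NeZero K] in
/-- Settled players occupy exactly the best arms. -/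
lemma Settled.sum_topArms {μ : Fin K → ℝ} (hμ : Function.Injective μ) {P : Finset ι}
    {s : ι → TrekState K} (H : Settled (Tuple.sort (fun k => -μ k)) P s) :
    ∑ k ∈ topArms μ P.card, μ k = ∑ j ∈ P, μ (Tuple.sort (fun k => -μ k) (s j).rank) := by
  obtain ⟨-, hinj, hlt⟩ := H
  set σ := Tuple.sort (fun k => -μ k)
  have hinj' : Set.InjOn (fun j => σ (s j).rank) (P : Set ι) :=
    fun i hi j hj h => hinj hi hj (σ.injective h)
  rw [← Finset.sum_image (f := μ) hinj']
  congr 1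
  symm
  apply Finset.eq_of_subset_of_card_le
  · intro k hk
    obtain ⟨j, hj, rfl⟩ := Finset.mem_image.1 hk
    rw [mem_topArms_iff hμ]
    simpa [σ] using hlt j hj
  · rw [Finset.card_image_of_injOn hinj', ← Finset.card_range P.card]
    refine Finset.card_le_card_of_injOn (fun k => (σ.symm k : ℕ)) ?_ ?_
    · intro k hk
      have := (mem_topArms_iff hμ _ k).1 hk
      simpa [σ] using this
    · intro i _ k _ h
      exact σ.symm.injective (Fin.ext h)

namespace Run

variable (R : Run ι K)

lemma choose_of_notMem {t : ℕ} {j : ι} (st : ι → PlayerState K) (h : j ∉ R.present t) :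
    R.choose t st j = none := by
  rw [choose, if_neg h]

lemma collides_choose {t : ℕ} {st : ι → PlayerState K} {a : ι → Fin K}
    (h : ∀ j ∈ R.present t, R.choose t st j = some (a j)) {j : ι} (hj : j ∈ R.present t) :
    collides (R.choose t st) j = decide (∃ i ∈ R.present t, i ≠ j ∧ a i = a j) := by
  rw [collides, decide_eq_decide, h j hj]
  constructor
  · rintro ⟨-, i, hij, hi⟩
    have hip : i ∈ R.present t := by
      by_contra hc
      rw [R.choose_of_notMem st hc] at hi
      simp at hi
    rw [h i hip] at hi
    exact ⟨i, hip, hij, Option.some_injective _ hi⟩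
  · rintro ⟨i, hip, hij, hi⟩
    exact ⟨by simp, i, hij, by rw [h i hip, hi]⟩

/-- The draws of the epoch that begins in round `t₀`. -/
def draws (t₀ s : ℕ) (j : ι) : Fin K := R.U j (t₀ + s)

/-- The rewards of the epoch that begins in round `t₀`. -/
def rewards (t₀ s : ℕ) (j : ι) : Fin K → ℝ := R.X j (t₀ + s)

lemma start_of_mod_eq_zero {t : ℕ} {j : ι} (hj : j ∈ R.present t) (ht : t % R.Tep = 0)
    (s : PlayerState K) : R.start t j s = .learning (LearnState.init K) := by
  unfold start
  rw [if_pos hj, if_pos ht]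

lemma start_of_mod_eq {t : ℕ} {j : ι} (hj : j ∈ R.present t) (h0 : t % R.Tep ≠ 0)
    (ht : t % R.Tep = R.T₀) (l : LearnState K) :
    R.start t j (.learning l) = .trekking (TrekState.init R.v l) := by
  unfold start
  rw [if_pos hj, if_neg h0, if_pos ht]

lemma start_of_mod_ne {t : ℕ} {j : ι} (hj : j ∈ R.present t) (h0 : t % R.Tep ≠ 0)
    (ht : t % R.Tep ≠ R.T₀) (s : PlayerState K) : R.start t j s = s := by
  unfold start
  rw [if_pos hj, if_neg h0, if_neg ht]

lemma state_succ (t : ℕ) (j : ι) :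
    R.state (t + 1) j = R.start (t + 1) j (R.finish t (R.state t) j) := rfl

lemma state_of_mod_eq_zero {t : ℕ} (ht : t % R.Tep = 0) {j : ι} (hj : j ∈ R.present t) :
    R.state t j = .learning (LearnState.init K) := by
  cases t with
  | zero => change R.start 0 j .waiting = _; exact R.start_of_mod_eq_zero hj ht _
  | succ t => exact R.start_of_mod_eq_zero hj ht _

lemma state_learning {e n : ℕ} {P : Finset ι} (hn : n ≤ R.Tep)
    (hP : ∀ s < n, R.present (e * R.Tep + s) = P) {s : ℕ} (hs : s < n) (hsT : s < R.T₀) :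
    ∀ j ∈ P, R.state (e * R.Tep + s) j =
      .learning (learnRun P (R.draws (e * R.Tep)) (R.rewards (e * R.Tep)) s j) := by
  induction s with
  | zero =>
    intro j hj
    exact R.state_of_mod_eq_zero (by simp) (by rw [hP 0 hs]; exact hj)
  | succ s ih =>
    intro j hj
    have hs' : s < n := by omega
    have ih' := ih hs' (by omega)
    have hmod : (e * R.Tep + s + 1) % R.Tep = s + 1 := by
      rw [add_assoc, Nat.mul_add_mod', Nat.mod_eq_of_lt (by omega)]
    have hj1 : j ∈ R.present (e * R.Tep + s + 1) := by rw [add_assoc, hP _ hs]; exact hj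
    rw [← add_assoc, state_succ, R.start_of_mod_ne hj1 (by omega) (by omega), finish]
    have hch : ∀ i ∈ R.present (e * R.Tep + s), R.choose (e * R.Tep + s)
        (R.state (e * R.Tep + s)) i =
        some ((learnRun P (R.draws (e * R.Tep)) (R.rewards (e * R.Tep)) s i).arm
          (R.draws (e * R.Tep) s i)) := by
      intro i hi
      rw [choose, if_pos hi, ih' i (by rw [← hP s hs']; exact hi)]
      rfl
    rw [R.collides_choose hch (by rw [hP s hs']; exact hj), ih' j hj, hP s hs']
    rfl

lemma state_trekking {e n : ℕ} {P : Finset ι} (hn : n ≤ R.Tep)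
    (hP : ∀ s < n, R.present (e * R.Tep + s) = P) (hT : 0 < R.T₀) {d : ℕ} (hd : R.T₀ + d < n) :
    ∀ j ∈ P, R.state (e * R.Tep + (R.T₀ + d)) j =
      .trekking (trekRun R.v P (fun j => TrekState.init R.v
        (learnRun P (R.draws (e * R.Tep)) (R.rewards (e * R.Tep)) R.T₀ j)) d j) := by
  induction d with
  | zero =>
    intro j hj
    obtain ⟨s, hs⟩ := Nat.exists_eq_succ_of_ne_zero hT.ne'
    have hs' : s < n := by omega
    have ih' := R.state_learning hn hP hs' (by omega)
    have hmod : (e * R.Tep + s + 1) % R.Tep = s + 1 := by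
      rw [add_assoc, Nat.mul_add_mod', Nat.mod_eq_of_lt (by omega)]
    have hj1 : j ∈ R.present (e * R.Tep + s + 1) := by
      rw [add_assoc, hP _ (by omega)]; exact hj
    have hch : ∀ i ∈ R.present (e * R.Tep + s), R.choose (e * R.Tep + s)
        (R.state (e * R.Tep + s)) i =
        some ((learnRun P (R.draws (e * R.Tep)) (R.rewards (e * R.Tep)) s i).arm
          (R.draws (e * R.Tep) s i)) := by
      intro i hi
      rw [choose, if_pos hi, ih' i (by rw [← hP s hs']; exact hi)]
      rfl
    rw [show e * R.Tep + (R.T₀ + 0) = e * R.Tep + s + 1 by omega, state_succ, finish,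
      R.collides_choose hch (by rw [hP s hs']; exact hj), ih' j hj, hP s hs']
    refine (R.start_of_mod_eq hj1 (by omega) (by omega) _).trans ?_
    rw [trekRun, hs]
    rfl
  | succ d ih =>
    intro j hj
    have hs' : R.T₀ + d < n := by omega
    have ih' := ih hs'
    have hmod : (e * R.Tep + (R.T₀ + d) + 1) % R.Tep = R.T₀ + d + 1 := by
      rw [add_assoc, Nat.mul_add_mod', Nat.mod_eq_of_lt (by omega)]
    have hj1 : j ∈ R.present (e * R.Tep + (R.T₀ + d) + 1) := by
      rw [add_assoc, hP _ (by omega)]; exact hj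
    have hch : ∀ i ∈ R.present (e * R.Tep + (R.T₀ + d)), R.choose (e * R.Tep + (R.T₀ + d))
        (R.state (e * R.Tep + (R.T₀ + d))) i =
        some ((trekRun R.v P (fun j => TrekState.init R.v
        (learnRun P (R.draws (e * R.Tep)) (R.rewards (e * R.Tep)) R.T₀ j)) d i).arm R.v) := by
      intro i hi
      rw [choose, if_pos hi, ih' i (by rw [← hP _ hs']; exact hi)]
    rw [show e * R.Tep + (R.T₀ + (d + 1)) = e * R.Tep + (R.T₀ + d) + 1 by omega, state_succ,
      R.start_of_mod_ne hj1 (by omega) (by omega), finish,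
      R.collides_choose hch (by rw [hP _ hs']; exact hj), ih' j hj, hP _ hs']
    rfl

/-- The contribution of a round to the regret. -/
noncomputable def roundRegret (μ : Fin K → ℝ) (t : ℕ) : ℝ :=
  ∑ k ∈ topArms μ (R.present t).card, μ k -
    ∑ j ∈ R.present t, meanOf μ (R.arm t j) * (1 - (R.eta t j : ℝ))

/-- The number of collisions in a round. -/
noncomputable def roundCollisions (t : ℕ) : ℕ := ∑ j ∈ R.present t, R.eta t j

lemma regret_eq_sum (μ : Fin K → ℝ) (T : ℕ) :
    R.regret μ T = ∑ t ∈ Finset.range T, R.roundRegret μ t := by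
  simp only [regret, roundRegret, Finset.sum_sub_distrib]

lemma eta_le_one (t : ℕ) (j : ι) : R.eta t j ≤ 1 := by
  unfold eta; split_ifs <;> simp

lemma roundRegret_le {μ : Fin K → ℝ} (hμ : ∀ k, μ k ∈ Set.Icc (0 : ℝ) 1) (t : ℕ) :
    R.roundRegret μ t ≤ K := by
  have h1 : ∑ k ∈ topArms μ (R.present t).card, μ k ≤ K := by
    calc ∑ k ∈ topArms μ (R.present t).card, μ k
        ≤ ∑ k ∈ topArms μ (R.present t).card, (1 : ℝ) := Finset.sum_le_sum fun k _ => (hμ k).2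
      _ = ((topArms μ (R.present t).card).card : ℝ) := by simp
      _ ≤ K := by
        have := Finset.card_le_univ (topArms μ (R.present t).card)
        rw [Fintype.card_fin] at this
        exact_mod_cast this
  have h2 : 0 ≤ ∑ j ∈ R.present t, meanOf μ (R.arm t j) * (1 - (R.eta t j : ℝ)) := by
    refine Finset.sum_nonneg fun j _ => mul_nonneg ?_ ?_
    · cases R.arm t j with
      | none => exact le_rfl
      | some k => exact (hμ k).1
    · have : (R.eta t j : ℝ) ≤ 1 := by exact_mod_cast R.eta_le_one t j
      linarith
  rw [roundRegret]
  linarith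

lemma roundCollisions_le {t : ℕ} (h : (R.present t).card ≤ K) : R.roundCollisions t ≤ K :=
  (Finset.sum_le_card_nsmul _ _ 1 fun j _ => R.eta_le_one t j).trans (by simpa using h)

/-- In an undisturbed good epoch there is neither regret nor a collision after the learning phase
and `K²` rounds of trekking. -/
lemma round_eq_zero {μ : Fin K → ℝ} {e n : ℕ} {P : Finset ι} (hn : n ≤ R.Tep)
    (hP : ∀ s < n, R.present (e * R.Tep + s) = P) (hPK : P.card ≤ K) {τ : ℕ} {θ ε n₀ : ℝ}
    (H : GoodEpoch P μ τ R.T₀ θ (R.draws (e * R.Tep)) (R.rewards (e * R.Tep)))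
    (hμ : ∀ k, μ k ∈ Set.Icc (0 : ℝ) 1) (hgap : ∀ i k, i ≠ k → ε < |μ i - μ k|)
    (hε : 0 < ε) (hθ : 0 ≤ θ) (hn₀ : 0 < n₀) (hτ : τ ≤ R.T₀) (hT : 0 < R.T₀)
    (hnn : n₀ ≤ ((R.T₀ - τ) / K : ℕ)) (hacc : τ / n₀ + 2 * θ ≤ ε)
    (hX : ∀ s < n, ∀ j ∈ P, ∀ k, R.X j (e * R.Tep + s) k ∈ Set.Icc (0 : ℝ) 1)
    {s : ℕ} (hs : s < n) (hsT : R.T₀ + K * K ≤ s) :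
    R.roundRegret μ (e * R.Tep + s) = 0 ∧ R.roundCollisions (e * R.Tep + s) = 0 := by
  obtain ⟨d, rfl⟩ := Nat.exists_eq_add_of_le (show R.T₀ ≤ s by omega)
  have hst := R.state_trekking hn hP hT hs
  have hinj : Function.Injective μ := by
    intro i k h
    by_contra hne
    have := hgap i k hne
    rw [h, sub_self, abs_zero] at this
    linarith
  have hset := settled_trekRun R.v hPK
    (fun j hj => H.ranking_eq hμ hgap hθ hn₀ hτ hnn hacc hj
      (fun t ht k => hX t (by omega) j hj k))
    (H.last_injOn hτ) (n := d) (by omega)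
  set S := trekRun R.v P (fun j => TrekState.init R.v
        (learnRun P (R.draws (e * R.Tep)) (R.rewards (e * R.Tep)) R.T₀ j)) d
  have hPs := hP _ hs
  set t := e * R.Tep + (R.T₀ + d)
  have harm : ∀ j ∈ R.present t,
      R.choose t (R.state t) j = some (Tuple.sort (fun k => -μ k) (S j).rank) := by
    intro j hj
    have hjP : j ∈ P := by rw [← hPs]; exact hj
    rw [choose, if_pos hj, hst j hjP]
    obtain ⟨hl, ho⟩ := hset.1 j hjP
    simp only [TrekState.arm, ho, hl, if_true]
    cases R.v <;> rfl
  have heta : ∀ j ∈ R.present t, R.eta t j = 0 := by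
    intro j hj
    unfold eta arm
    rw [R.collides_choose harm hj, if_neg]
    rw [decide_eq_true_eq]
    rintro ⟨i, hi, hij, he⟩
    rw [hPs] at hi hj
    exact hij (hset.2.1 hi hj ((Tuple.sort (fun k => -μ k)).injective he))
  constructor
  · rw [roundRegret, sub_eq_zero]
    rw [show (R.present t).card = P.card by rw [hPs], hset.sum_topArms hinj, ← hPs]
    refine Finset.sum_congr rfl fun j hj => ?_
    rw [heta j hj, arm, harm j hj]
    simp [meanOf]
  · exact Finset.sum_eq_zero heta

end Run

end Epoch

/-! ### Probability bounds -/

section Probability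

variable {Ω : Type*} [MeasurableSpace Ω] {ι : Type*} [DecidableEq ι] {K : ℕ} [NeZero K]

lemma one_le_mul_one_sub_pow {r : ℕ} (hr : 1 ≤ r) (hrK : r ≤ K) :
    (1 : ℝ) ≤ r * (1 - 1 / (K : ℝ)) ^ (r - 1) := by
  have hK : (0 : ℝ) < K := by exact_mod_cast Nat.pos_of_ne_zero (NeZero.ne K)
  have hr' : (1 : ℝ) ≤ r := by exact_mod_cast hr
  have hrK' : (r : ℝ) ≤ K := by exact_mod_cast hrK
  have h1K : (1 : ℝ) / K ≤ 1 := by rw [div_le_one hK]; linarith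
  have hb := one_add_mul_le_pow (a := -(1 / (K : ℝ))) (by linarith) (r - 1)
  rw [Nat.cast_sub hr, Nat.cast_one, ← sub_eq_add_neg] at hb
  have h2 : (1 : ℝ) ≤ r * (1 + ((r : ℝ) - 1) * -(1 / K)) := by
    have : (r : ℝ) * (1 + ((r : ℝ) - 1) * -(1 / K)) - 1 = ((r - 1) * (K - r)) / K := by
      field_simp
      ring
    have : 0 ≤ ((r - 1) * (K - r) : ℝ) / K := by
      apply div_nonneg (mul_nonneg _ _) hK.le <;> linarith
    linarith
  exact h2.trans (mul_le_mul_of_nonneg_left hb (by linarith))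

/-- A player whose indicator is not yet set has a collision-free play with probability at least
`1 / K`. -/
lemma inv_le_measureReal_clean {Pr : Measure Ω} [IsProbabilityMeasure Pr] {Y : ι → Ω → Fin K}
    (hmeas : ∀ i, Measurable (Y i)) (hlaw : ∀ i k, Pr.real (Y i ⁻¹' {k}) = 1 / (K : ℝ))
    (hind : iIndepFun Y Pr) {P : Finset ι} (hP : P.card ≤ K) {c : ι → Bool × Fin K} {j : ι} (hj : j ∈ P) (hcj : (c j).1 = false) :
    1 / (K : ℝ) ≤ Pr.real {ω | (chairStep P (fun i => Y i ω) c j).1 = true} := by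
  have hK : (0 : ℝ) < K := by exact_mod_cast Nat.pos_of_ne_zero (NeZero.ne K)
  set Q := P.filter (fun i => (c i).1 = false) with hQ
  set D := P.filter (fun i => ¬ (c i).1 = false) with hD
  set F : Finset (Fin K) := Finset.univ \ D.image (fun i => (c i).2 + 1) with hF
  have hjQ : j ∈ Q := Finset.mem_filter.2 ⟨hj, hcj⟩
  have hcard : Q.card ≤ F.card := by
    have h1 : Q.card + D.card = P.card :=
      Finset.card_filter_add_card_filter_not (s := P) (fun i => (c i).1 = false)
    have h2 : (D.image (fun i => (c i).2 + 1)).card ≤ D.card := Finset.card_image_le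
    have h3 := Finset.card_sdiff_add_card_eq_card
      (Finset.subset_univ (D.image (fun i => (c i).2 + 1)))
    rw [Finset.card_univ, Fintype.card_fin, ← hF] at h3
    omega
  set B : Fin K → ι → Set (Fin K) := fun a i => if i = j then {a} else {a}ᶜ with hB
  set A : Fin K → Set Ω := fun a => ⋂ i ∈ Q, Y i ⁻¹' B a i with hA
  have hAmeas : ∀ a, MeasurableSet (A a) := fun a =>
    Finset.measurableSet_biInter _ fun i _ => hmeas i (Set.toFinite _).measurableSet
  have hAprob : ∀ a, Pr.real (A a) = 1 / K * (1 - 1 / (K : ℝ)) ^ (Q.card - 1) := by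
    intro a
    have h1 := hind.measure_inter_preimage_eq_mul (S := Q) (sets := B a)
      (fun i _ => (Set.toFinite _).measurableSet)
    rw [measureReal_def, h1, ENNReal.toReal_prod, ← Finset.mul_prod_erase Q _ hjQ]
    congr 1
    · simp only [hB, if_true]
      exact hlaw j a
    · rw [← Finset.card_erase_of_mem hjQ, ← Finset.prod_const]
      refine Finset.prod_congr rfl fun i hi => ?_
      simp only [hB, if_neg (Finset.ne_of_mem_erase hi), Set.preimage_compl]
      rw [← hlaw i a, ← measureReal_def,
        probReal_compl_eq_one_sub (hmeas i (measurableSet_singleton a))]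
  have hdisj : Set.PairwiseDisjoint (F : Set (Fin K)) A := by
    intro a _ b _ hab
    rw [Function.onFun, Set.disjoint_left]
    intro ω ha hb
    have h1 : ω ∈ Y j ⁻¹' B a j := Set.mem_iInter₂.1 ha j hjQ
    have h2 : ω ∈ Y j ⁻¹' B b j := Set.mem_iInter₂.1 hb j hjQ
    simp only [hB, if_true, Set.mem_preimage, Set.mem_singleton_iff] at h1 h2
    exact hab (h1.symm.trans h2)
  have hsub : (⋃ a ∈ F, A a) ⊆ {ω | (chairStep P (fun i => Y i ω) c j).1 = true} := by
    intro ω hω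
    obtain ⟨a, haF, ha⟩ := Set.mem_iUnion₂.1 hω
    have h1 : ω ∈ Y j ⁻¹' B a j := Set.mem_iInter₂.1 ha j hjQ
    simp only [hB, if_true, Set.mem_preimage, Set.mem_singleton_iff] at h1
    simp only [Set.mem_ofPred_eq, chairStep, hcj, Bool.false_or, Bool.not_eq_true',
      decide_eq_false_iff_not]
    rintro ⟨i, hi, hij, he⟩
    rw [seatArm, seatArm, hcj, h1] at he
    cases hci : (c i).1
    · have h2 : ω ∈ Y i ⁻¹' B a i := Set.mem_iInter₂.1 ha i (Finset.mem_filter.2 ⟨hi, hci⟩)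
      simp only [hB, if_neg hij, Set.mem_preimage, Set.mem_compl_iff,
        Set.mem_singleton_iff] at h2
      simp only [hci, Bool.false_eq_true, if_false] at he
      exact h2 he
    · simp only [hci, if_true, Bool.false_eq_true, if_false] at he
      rw [hF, Finset.mem_sdiff] at haF
      exact haF.2 (Finset.mem_image.2 ⟨i, Finset.mem_filter.2 ⟨hi, by simp [hci]⟩, he⟩)
  refine le_trans ?_ (measureReal_mono hsub)
  rw [measureReal_biUnion_finset hdisj fun a _ => hAmeas a, Finset.sum_congr rfl fun a _ => hAprob a,
    Finset.sum_const, nsmul_eq_mul]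
  have hQ1 : 1 ≤ Q.card := Finset.card_pos.2 ⟨j, hjQ⟩
  have hQK : Q.card ≤ K := (Finset.card_filter_le _ _).trans hP
  have h1 := one_le_mul_one_sub_pow (K := K) hQ1 hQK
  have h1K : (1 : ℝ) / K ≤ 1 := by
    rw [div_le_one hK]
    exact_mod_cast hQ1.trans hQK
  have h2 : (0 : ℝ) ≤ (1 - 1 / (K : ℝ)) ^ (Q.card - 1) := pow_nonneg (by linarith) _
  have h3 : (Q.card : ℝ) ≤ F.card := by exact_mod_cast hcard
  calc (1 : ℝ) / K = 1 / K * 1 := by ring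
    _ ≤ 1 / K * (Q.card * (1 - 1 / (K : ℝ)) ^ (Q.card - 1)) := by gcongr
    _ ≤ 1 / K * (F.card * (1 - 1 / (K : ℝ)) ^ (Q.card - 1)) := by gcongr
    _ = _ := by ring

variable [Fintype ι]

lemma measurable_chairs {U : ι → ℕ → Ω → Fin K} (hmeas : ∀ i t, Measurable (U i t))
    (P : Finset ι) (t₀ n : ℕ) :
    Measurable (fun ω => chairs P (fun s i => U i (t₀ + s) ω) n) := by
  induction n with
  | zero => exact measurable_const
  | succ n ih =>
    have h1 : Measurable (fun ω => ((fun i => U i (t₀ + n) ω),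
        chairs P (fun s i => U i (t₀ + s) ω) n)) :=
      (measurable_pi_lambda _ fun i => hmeas i _).prodMk ih
    exact (measurable_of_countable (fun p : (ι → Fin K) × (ι → Bool × Fin K) =>
      chairStep P p.1 p.2)).comp h1

lemma indepFun_chairs {Pr : Measure Ω} {U : ι → ℕ → Ω → Fin K}
    (hmeas : ∀ i t, Measurable (U i t)) (hind : iIndepFun (fun p : ι × ℕ => U p.1 p.2) Pr)
    (P : Finset ι) (t₀ n : ℕ) :
    IndepFun (fun ω => chairs P (fun s i => U i (t₀ + s) ω) n) (fun ω i => U i (t₀ + n) ω) Pr := by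
  classical
  set S : Finset (ι × ℕ) := Finset.univ ×ˢ Finset.Ico t₀ (t₀ + n) with hS
  set S' : Finset (ι × ℕ) := Finset.univ ×ˢ {t₀ + n} with hS'
  have hdisj : Disjoint S S' := by
    rw [Finset.disjoint_left]
    rintro ⟨i, t⟩ h1 h2
    simp only [hS, hS', Finset.mem_product, Finset.mem_univ, true_and, Finset.mem_Ico,
      Finset.mem_singleton] at h1 h2
    omega
  have h := hind.indepFun_finset S S' hdisj fun p => hmeas p.1 p.2
  let φ : (S → Fin K) → (ι → Bool × Fin K) := fun f =>
    chairs P (fun s i => if h : (i, t₀ + s) ∈ S then f ⟨_, h⟩ else 0) n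
  let ψ : (S' → Fin K) → (ι → Fin K) := fun f i => f ⟨(i, t₀ + n), by simp [hS']⟩
  have h2 := h.comp (φ := φ) (ψ := ψ) (measurable_of_countable _) (measurable_of_countable _)
  have hφ : (fun ω => chairs P (fun s i => U i (t₀ + s) ω) n) =
      φ ∘ fun ω (p : S) => U p.1.1 p.1.2 ω := by
    funext ω
    refine chairs_congr P fun m hm => ?_
    funext i
    have hmem : (i, t₀ + m) ∈ S := by
      simp only [hS, Finset.mem_product, Finset.mem_univ, true_and, Finset.mem_Ico]
      omega
    simp only [dif_pos hmem]
  rw [hφ]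
  exact h2

/-- The probability that a player has no collision-free play in `n` rounds. -/
lemma measureReal_not_fixed_le {Pr : Measure Ω} [IsProbabilityMeasure Pr]
    {U : ι → ℕ → Ω → Fin K} (hmeas : ∀ i t, Measurable (U i t))
    (hlaw : ∀ i t k, Pr.real (U i t ⁻¹' {k}) = 1 / (K : ℝ))
    (hind : iIndepFun (fun p : ι × ℕ => U p.1 p.2) Pr) {P : Finset ι} (hP : P.card ≤ K) {j : ι}
    (hj : j ∈ P) (t₀ n : ℕ) :
    Pr.real {ω | (chairs P (fun s i => U i (t₀ + s) ω) n j).1 = false} ≤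
      (1 - 1 / (K : ℝ)) ^ n := by
  classical
  induction n with
  | zero => simp
  | succ n ih =>
    set C := fun ω => chairs P (fun s i => U i (t₀ + s) ω) n with hC
    set Y := fun ω i => U i (t₀ + n) ω with hY
    have hCm : Measurable C := measurable_chairs hmeas P t₀ n
    have hYm : Measurable Y := measurable_pi_lambda _ fun i => hmeas i _
    have hCY : IndepFun C Y Pr := indepFun_chairs hmeas hind P t₀ n
    set G : Finset (ι → Bool × Fin K) :=
      Finset.univ.filter (fun c => (c j).1 = false) with hG
    set N : (ι → Bool × Fin K) → Set (ι → Fin K) := fun c =>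
      {y | (chairStep P y c j).1 = false} with hN
    have hNm : ∀ c, MeasurableSet (N c) := fun c => (Set.toFinite _).measurableSet
    have hsub : {ω | (chairs P (fun s i => U i (t₀ + s) ω) (n + 1) j).1 = false} ⊆
        ⋃ c ∈ G, (C ⁻¹' {c} ∩ Y ⁻¹' N c) := by
      intro ω hω
      refine Set.mem_iUnion₂.2 ⟨C ω, ?_, rfl, hω⟩
      refine Finset.mem_filter.2 ⟨Finset.mem_univ _, ?_⟩
      have h1 : ((C ω j).1 || !decide (∃ i ∈ P, i ≠ j ∧
          seatArm (C ω i) (Y ω i) = seatArm (C ω j) (Y ω j))) = false := hω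
      exact (Bool.or_eq_false_iff.1 h1).1
    have hprob : ∀ c ∈ G, Pr.real (C ⁻¹' {c} ∩ Y ⁻¹' N c) ≤
        Pr.real (C ⁻¹' {c}) * (1 - 1 / (K : ℝ)) := by
      intro c hc
      obtain ⟨-, hc2⟩ := Finset.mem_filter.1 hc
      rw [measureReal_def, hCY.measure_inter_preimage_eq_mul _ _ (measurableSet_singleton c)
        (hNm c), ENNReal.toReal_mul, ← measureReal_def, ← measureReal_def]
      refine mul_le_mul_of_nonneg_left ?_ measureReal_nonneg
      have hind' : iIndepFun (fun i => U i (t₀ + n)) Pr :=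
        hind.precomp (g := fun i : ι => (i, t₀ + n)) (fun a b h => (Prod.mk.inj h).1)
      have h1 := inv_le_measureReal_clean (fun i => hmeas i (t₀ + n))
        (fun i k => hlaw i (t₀ + n) k) hind' hP hj hc2
      have h2 : Y ⁻¹' N c =
          {ω | (chairStep P (fun i => U i (t₀ + n) ω) c j).1 = true}ᶜ := by
        ext ω
        simp [hN, hY]
      have h3 : MeasurableSet {ω | (chairStep P (fun i => U i (t₀ + n) ω) c j).1 = true} := by
        rw [← compl_compl {ω | (chairStep P (fun i => U i (t₀ + n) ω) c j).1 = true}, ← h2]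
        exact (hYm (hNm c)).compl
      rw [h2, probReal_compl_eq_one_sub h3]
      linarith
    have hGsum : ∑ c ∈ G, Pr.real (C ⁻¹' {c}) ≤ Pr.real {ω | (C ω j).1 = false} := by
      rw [← measureReal_biUnion_finset]
      · refine measureReal_mono ?_
        intro ω hω
        obtain ⟨c, hc, hcω⟩ := Set.mem_iUnion₂.1 hω
        have : C ω = c := hcω
        rw [Set.mem_ofPred_eq, this]
        exact (Finset.mem_filter.1 hc).2
      · intro a _ b _ hab
        rw [Function.onFun, Set.disjoint_left]
        intro ω h1 h2
        exact hab ((show C ω = a from h1).symm.trans h2)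
      · exact fun c _ => hCm (measurableSet_singleton c)
    have hK1 : (0 : ℝ) ≤ 1 - 1 / K := by
      have : (1 : ℝ) ≤ K := by exact_mod_cast Nat.pos_of_ne_zero (NeZero.ne K)
      rw [sub_nonneg, div_le_one (by linarith)]
      exact this
    calc Pr.real {ω | (chairs P (fun s i => U i (t₀ + s) ω) (n + 1) j).1 = false}
        ≤ Pr.real (⋃ c ∈ G, (C ⁻¹' {c} ∩ Y ⁻¹' N c)) := measureReal_mono hsub (measure_ne_top _ _)
      _ ≤ ∑ c ∈ G, Pr.real (C ⁻¹' {c} ∩ Y ⁻¹' N c) := measureReal_biUnion_finset_le _ _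
      _ ≤ ∑ c ∈ G, Pr.real (C ⁻¹' {c}) * (1 - 1 / (K : ℝ)) := Finset.sum_le_sum hprob
      _ = (∑ c ∈ G, Pr.real (C ⁻¹' {c})) * (1 - 1 / (K : ℝ)) := by rw [Finset.sum_mul]
      _ ≤ (1 - 1 / (K : ℝ)) ^ n * (1 - 1 / (K : ℝ)) :=
          mul_le_mul_of_nonneg_right (hGsum.trans ih) hK1
      _ = _ := (pow_succ _ _).symm

omit [Fintype ι] [DecidableEq ι] [NeZero K] in
/-- Hoeffding's inequality for the average of independent variables with values in `[0, 1]`. -/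
lemma measureReal_abs_sum_sub_gt_le {Pr : Measure Ω} [IsProbabilityMeasure Pr] {κ : Type*}
    {Z : κ → Ω → ℝ} (hmeas : ∀ i, Measurable (Z i)) (hind : iIndepFun Z Pr)
    (hb : ∀ i, ∀ᵐ ω ∂Pr, Z i ω ∈ Set.Icc (0 : ℝ) 1) {m : ℝ} (hm : ∀ i, ∫ ω, Z i ω ∂Pr = m)
    {θ : ℝ} (hθ : 0 ≤ θ) (S : Finset κ) :
    Pr.real {ω | S.card * θ < |∑ i ∈ S, Z i ω - S.card * m|} ≤
      2 * Real.exp (-(2 * S.card * θ ^ 2)) := by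
  have hsg : ∀ i, HasSubgaussianMGF (fun ω => Z i ω - m) (1 / 4) Pr := by
    intro i
    have h := hasSubgaussianMGF_of_mem_Icc (hmeas i).aemeasurable (hb i)
    rw [hm i] at h
    convert h using 1
    norm_num
  have hi1 : iIndepFun (fun i ω => Z i ω - m) Pr :=
    hind.comp (fun _ x => x - m) fun _ => measurable_id.sub_const _
  have hi2 : iIndepFun (fun i ω => -(Z i ω - m)) Pr :=
    hind.comp (fun _ x => -(x - m)) fun _ => (measurable_id.sub_const _).neg
  have hexp : Real.exp (-(S.card * θ) ^ 2 / (2 * ((∑ _i ∈ S, (1 / 4 : NNReal) : NNReal) : ℝ))) ≤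
      Real.exp (-(2 * S.card * θ ^ 2)) := by
    rw [Real.exp_le_exp]
    rcases Nat.eq_zero_or_pos S.card with h0 | h0
    · simp [h0]
    · have : (0 : ℝ) < S.card := by exact_mod_cast h0
      apply le_of_eq
      simp only [Finset.sum_const, nsmul_eq_mul]
      push_cast
      field_simp
      norm_num
  have h1 := (HasSubgaussianMGF.measure_sum_ge_le_of_iIndepFun hi1 (s := S)
    (c := fun _ => 1 / 4) (fun i _ => hsg i) (ε := S.card * θ) (by positivity)).trans hexp
  have h2 := (HasSubgaussianMGF.measure_sum_ge_le_of_iIndepFun hi2 (s := S)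
    (c := fun _ => 1 / 4) (fun i _ => (hsg i).neg) (ε := S.card * θ) (by positivity)).trans hexp
  have hsub : {ω | S.card * θ < |∑ i ∈ S, Z i ω - S.card * m|} ⊆
      {ω | S.card * θ ≤ ∑ i ∈ S, (Z i ω - m)} ∪ {ω | S.card * θ ≤ ∑ i ∈ S, -(Z i ω - m)} := by
    intro ω hω
    have he : ∑ i ∈ S, (Z i ω - m) = ∑ i ∈ S, Z i ω - S.card * m := by
      rw [Finset.sum_sub_distrib, Finset.sum_const, nsmul_eq_mul]
    simp only [Set.mem_union, Set.mem_ofPred_eq, Finset.sum_neg_distrib, he] at hω ⊢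
    exact (lt_abs.1 hω).imp le_of_lt le_of_lt
  calc _ ≤ _ := measureReal_mono hsub
    _ ≤ _ := measureReal_union_le _ _
    _ ≤ _ := by linarith

end Probability

/-! ### Choice of the parameters -/

section Parameters

lemma mul_gap_le_one {K : ℕ} {μ : Fin K → ℝ} {ε : ℝ} (hε : 0 < ε)
    (hμ : ∀ k, μ k ∈ Set.Icc (0 : ℝ) 1) (hgap : ∀ i k, i ≠ k → ε < |μ i - μ k|) :
    K * ε ≤ 1 + ε := by
  have hinj : Set.InjOn (fun k => ⌊μ k / ε⌋₊) (Finset.univ : Finset (Fin K)) := by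
    intro i _ k _ h
    by_contra hne
    have hg := hgap i k hne
    have hi0 : 0 ≤ μ i / ε := div_nonneg (hμ i).1 hε.le
    have hk0 : 0 ≤ μ k / ε := div_nonneg (hμ k).1 hε.le
    have h' : (⌊μ i / ε⌋₊ : ℝ) = ⌊μ k / ε⌋₊ := by exact_mod_cast h
    have h1 := Nat.floor_le hi0
    have h2 := Nat.lt_floor_add_one (μ i / ε)
    have h3 := Nat.floor_le hk0
    have h4 := Nat.lt_floor_add_one (μ k / ε)
    have h5 : |μ i / ε - μ k / ε| < 1 := by rw [abs_lt]; constructor <;> linarith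
    rw [← sub_div, abs_div, abs_of_pos hε, div_lt_one hε] at h5
    linarith
  have hcard := Finset.card_le_card_of_injOn (t := Finset.range (⌊1 / ε⌋₊ + 1)) _
    (fun k _ => by
      simp only [Finset.coe_range, Set.mem_Iio]
      exact Nat.lt_succ_of_le (Nat.floor_le_floor (by gcongr; exact (hμ k).2))) hinj
  rw [Finset.card_univ, Fintype.card_fin, Finset.card_range] at hcard
  have h1 : (K : ℝ) ≤ ⌊1 / ε⌋₊ + 1 := by exact_mod_cast hcard
  have h2 := Nat.floor_le (show 0 ≤ 1 / ε by positivity)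
  have h3 : (K : ℝ) ≤ 1 / ε + 1 := by linarith
  calc K * ε ≤ (1 / ε + 1) * ε := by gcongr
    _ = 1 + ε := by field_simp

/-- The number of rounds in which all players have a collision-free play. -/
noncomputable def fixLen (K T : ℕ) : ℕ := ⌊(K : ℝ) / 2 * Real.log T⌋₊

/-- A lower bound for the number of plays of each arm after `fixLen K T` rounds. -/
noncomputable def playBound (ε : ℝ) (T : ℕ) : ℝ := (2 / ε ^ 2 + 2) * Real.log T

/-- The accuracy of the empirical means in a good epoch. -/
noncomputable def accuracy (ε : ℝ) : ℝ := ε * (1 - (1 + ε) / (4 * (1 + ε ^ 2))) / 2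

variable {K T : ℕ} {ε δ : ℝ}

lemma half_lt_log (hT : 2 ≤ T) : 1 / 2 < Real.log T := by
  have h1 : Real.log 2 ≤ Real.log T := Real.log_le_log (by norm_num) (by exact_mod_cast hT)
  have := Real.log_two_gt_d9
  linarith

lemma playBound_pos (hε : 0 < ε) (hT : 2 ≤ T) : 0 < playBound ε T := by
  have := half_lt_log hT
  unfold playBound
  positivity

lemma accuracy_nonneg (hε : 0 < ε) : 0 ≤ accuracy ε := by
  unfold accuracy
  have : (1 + ε) / (4 * (1 + ε ^ 2)) ≤ 1 := by
    rw [div_le_one (by positivity)]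
    nlinarith [sq_nonneg (ε - 1)]
  have : 0 ≤ 1 - (1 + ε) / (4 * (1 + ε ^ 2)) := by linarith
  positivity

lemma fixLen_le : (fixLen K T : ℝ) ≤ K / 2 * Real.log T :=
  Nat.floor_le (by have := Real.log_natCast_nonneg T; positivity)

lemma fixLen_div_add_le (hε : 0 < ε) (hT : 2 ≤ T) (hK : K * ε ≤ 1 + ε) :
    fixLen K T / playBound ε T + 2 * accuracy ε ≤ ε := by
  have hl : 0 < Real.log T := by have := half_lt_log hT; linarith
  have h1 : fixLen K T / playBound ε T ≤ ε * ((1 + ε) / (4 * (1 + ε ^ 2))) := by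
    rw [div_le_iff₀ (playBound_pos hε hT)]
    have h2 : ε * ((1 + ε) / (4 * (1 + ε ^ 2))) * playBound ε T =
        (1 + ε) / ε / 2 * Real.log T := by
      unfold playBound
      field_simp
      ring
    rw [h2]
    refine fixLen_le.trans ?_
    gcongr
    rwa [le_div_iff₀ hε]
  unfold accuracy
  linarith

lemma half_log_le_playBound_mul (hε : 0 < ε) :
    1 / 2 * Real.log T ≤ 2 * playBound ε T * accuracy ε ^ 2 := by
  have hl := Real.log_natCast_nonneg T
  have h1 : 2 * playBound ε T * accuracy ε ^ 2 =
      ((3 / 4 - ε / 4 + ε ^ 2) ^ 2 / (1 + ε ^ 2)) * Real.log T := by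
    unfold playBound accuracy
    field_simp
    ring
  rw [h1]
  refine mul_le_mul_of_nonneg_right ?_ hl
  rw [le_div_iff₀ (by positivity)]
  nlinarith [sq_nonneg (ε - 1 / 5), sq_nonneg (ε * (ε - 1 / 4)), sq_nonneg ε]

lemma log_inv_bound (hK : 2 ≤ K) :
    0 < -Real.log (1 - 1 / (4 * K)) ∧ -Real.log (1 - 1 / (4 * (K : ℝ))) ≤ 1 / (4 * K - 1) := by
  have hK' : (2 : ℝ) ≤ K := by exact_mod_cast hK
  have h1 : (1 : ℝ) / (4 * K) < 1 := by rw [div_lt_one (by linarith)]; linarith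
  have h0 : (0 : ℝ) < 1 / (4 * K) := by positivity
  constructor
  · have := Real.log_neg (x := 1 - 1 / (4 * (K : ℝ))) (by linarith) (by linarith)
    linarith
  · rw [← Real.log_inv]
    refine (Real.log_le_sub_one_of_pos (inv_pos.2 (by linarith))).trans (le_of_eq ?_)
    have : (4 * K - 1 : ℝ) ≠ 0 := by linarith
    field_simp
    ring

lemma log_confidence (hK : 2 ≤ K) (hT : 2 ≤ T) (hδ : 0 < δ) :
    Real.log (δ / T / (2 * K)) = -(Real.log T + Real.log (2 * K / δ)) ∧
      Real.log (4 * (K : ℝ) ^ 2 / (δ / T)) = Real.log T + Real.log (4 * K ^ 2 / δ) := by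
  have hK' : (0 : ℝ) < K := by exact_mod_cast (by omega : 0 < K)
  have hT' : (0 : ℝ) < T := by exact_mod_cast (by omega : 0 < T)
  constructor
  · rw [← Real.log_mul (by positivity) (by positivity), ← Real.log_inv]
    congr 1
    field_simp
  · rw [← Real.log_mul (by positivity) (by positivity)]
    congr 1
    field_simp

lemma learnLen_ge (hK : 2 ≤ K) (hT : 2 ≤ T) (hε : 0 < ε) (hδ : 0 < δ) (hδ1 : δ < 1) :
    fixLen K T + K * playBound ε T + K ≤ learnLen K ε (δ / T) := by
  have hK' : (2 : ℝ) ≤ K := by exact_mod_cast hK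
  have hl := half_lt_log hT
  obtain ⟨h1, h2⟩ := log_confidence hK hT hδ
  obtain ⟨h3, h4⟩ := log_inv_bound hK
  have h5 : 1 ≤ Real.log (2 * K / δ) := by
    have h4' : Real.log 4 ≤ Real.log (2 * K / δ) := by
      refine Real.log_le_log (by norm_num) ?_
      rw [le_div_iff₀ hδ]
      nlinarith
    have h6 : Real.log 4 = 2 * Real.log 2 := by
      rw [show (4 : ℝ) = 2 ^ 2 by norm_num, Real.log_pow]; norm_num
    have := Real.log_two_gt_d9
    linarith
  have h6 : 0 ≤ Real.log (4 * K ^ 2 / δ) := by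
    refine Real.log_nonneg ?_
    rw [le_div_iff₀ hδ]
    nlinarith
  have h7 : (4 * K - 1 : ℝ) * (Real.log T + 1) ≤
      Real.log (δ / T / (2 * K)) / Real.log (1 - 1 / (4 * K)) := by
    rw [h1, ← neg_div_neg_eq, neg_neg, le_div_iff₀ h3]
    rw [le_div_iff₀ (by linarith)] at h4
    have h8 : (0 : ℝ) ≤ Real.log T + 1 := by linarith
    nlinarith [mul_le_mul_of_nonneg_left h4 h8]
  have h8 : 2 * K / ε ^ 2 * Real.log T ≤
      2 * K / ε ^ 2 * Real.log (4 * (K : ℝ) ^ 2 / (δ / T)) := by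
    rw [h2]
    gcongr
    linarith
  have h9 := Nat.le_ceil (Real.log (δ / T / (2 * K)) / Real.log (1 - 1 / (4 * K)))
  have h10 := Nat.le_ceil (2 * K / ε ^ 2 * Real.log (4 * (K : ℝ) ^ 2 / (δ / T)))
  have h11 : (fixLen K T : ℝ) ≤ K / 2 * Real.log T := fixLen_le
  have h12 : K * playBound ε T = 2 * K / ε ^ 2 * Real.log T + 2 * K * Real.log T := by
    unfold playBound; ring
  rw [learnLen, Nat.cast_add, h12]
  nlinarith

lemma fixLen_le_learnLen (hK : 2 ≤ K) (hT : 2 ≤ T) (hε : 0 < ε) (hδ : 0 < δ) (hδ1 : δ < 1) :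
    fixLen K T ≤ learnLen K ε (δ / T) ∧ 0 < learnLen K ε (δ / T) ∧
      playBound ε T ≤ ((learnLen K ε (δ / T) - fixLen K T) / K : ℕ) := by
  have hK' : (0 : ℝ) < K := by exact_mod_cast (by omega : 0 < K)
  have h1 := learnLen_ge hK hT hε hδ hδ1
  have h2 := playBound_pos hε hT
  have h3 : (0 : ℝ) ≤ fixLen K T := Nat.cast_nonneg _
  have h4 : fixLen K T ≤ learnLen K ε (δ / T) := by
    have : (fixLen K T : ℝ) ≤ learnLen K ε (δ / T) := by nlinarith
    exact_mod_cast this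
  refine ⟨h4, ?_, ?_⟩
  · have : (0 : ℝ) < learnLen K ε (δ / T) := by nlinarith
    exact_mod_cast this
  · have h5 := Nat.lt_mul_div_succ (learnLen K ε (δ / T) - fixLen K T) (by omega : 0 < K)
    have h6 : ((learnLen K ε (δ / T) - fixLen K T : ℕ) : ℝ) <
        K * (((learnLen K ε (δ / T) - fixLen K T) / K : ℕ) + 1) := by exact_mod_cast h5
    rw [Nat.cast_sub h4] at h6
    have h7 : K * playBound ε T ≤ K * ((learnLen K ε (δ / T) - fixLen K T) / K : ℕ) := by
      linarith
    exact le_of_mul_le_mul_left h7 hK'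

/-- The learning phase has logarithmic length. -/
lemma exists_learnLen_le (hK : 2 ≤ K) (ε : ℝ) (hδ : 0 < δ) (hδ1 : δ < 1) :
    ∃ c : ℝ, 0 ≤ c ∧ ∀ T : ℕ, 2 ≤ T → (learnLen K ε (δ / T) : ℝ) ≤ c * Real.log T := by
  have hK' : (2 : ℝ) ≤ K := by exact_mod_cast hK
  set g := -Real.log (1 - 1 / (4 * (K : ℝ))) with hg
  obtain ⟨h3, -⟩ := log_inv_bound hK
  have h5 : 0 ≤ Real.log (2 * K / δ) := by
    refine Real.log_nonneg ?_
    rw [le_div_iff₀ hδ]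
    nlinarith
  have h6 : 0 ≤ Real.log (4 * K ^ 2 / δ) := by
    refine Real.log_nonneg ?_
    rw [le_div_iff₀ hδ]
    nlinarith
  refine ⟨1 / g * (1 + 2 * Real.log (2 * K / δ)) +
    2 * K / ε ^ 2 * (1 + 2 * Real.log (4 * K ^ 2 / δ)) + 4, by positivity, fun T hT => ?_⟩
  have hl := half_lt_log hT
  obtain ⟨h1, h2⟩ := log_confidence hK hT hδ
  have h7 : Real.log (δ / T / (2 * K)) / Real.log (1 - 1 / (4 * K)) =
      1 / g * (Real.log T + Real.log (2 * K / δ)) := by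
    rw [h1, hg, ← neg_div_neg_eq, neg_neg]
    ring
  have h9 := Nat.ceil_lt_add_one (a := Real.log (δ / T / (2 * K)) / Real.log (1 - 1 / (4 * K)))
    (by rw [h7]; positivity)
  have h10 := Nat.ceil_lt_add_one (a := 2 * K / ε ^ 2 * Real.log (4 * (K : ℝ) ^ 2 / (δ / T)))
    (by rw [h2]; positivity)
  rw [h7] at h9
  rw [h2] at h10
  rw [learnLen, Nat.cast_add, h7, h2]
  have h11 : 1 / g * (Real.log T + Real.log (2 * K / δ)) ≤
      1 / g * (Real.log T + 2 * Real.log T * Real.log (2 * K / δ)) := by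
    gcongr
    nlinarith
  have h12 : 2 * K / ε ^ 2 * (Real.log T + Real.log (4 * K ^ 2 / δ)) ≤
      2 * K / ε ^ 2 * (Real.log T + 2 * Real.log T * Real.log (4 * K ^ 2 / δ)) := by
    gcongr
    nlinarith
  nlinarith

lemma exp_neg_half_log (hT : 2 ≤ T) : Real.exp (-(1 / 2 * Real.log T)) = 1 / Real.sqrt T := by
  have hT' : (0 : ℝ) < T := by exact_mod_cast (by omega : 0 < T)
  rw [Real.exp_neg, one_div, mul_comm, Real.exp_mul, Real.exp_log hT', Real.sqrt_eq_rpow]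
  simp

lemma one_sub_pow_fixLen_le (hK : 2 ≤ K) (hT : 2 ≤ T) :
    (1 - 1 / (K : ℝ)) ^ fixLen K T ≤ 3 / Real.sqrt T := by
  have hK' : (2 : ℝ) ≤ K := by exact_mod_cast hK
  have h1 : (1 : ℝ) / K ≤ 1 := by rw [div_le_one (by linarith)]; linarith
  have h2 : 1 - 1 / (K : ℝ) ≤ Real.exp (-(1 / K)) := Real.one_sub_le_exp_neg _
  have h3 := Nat.lt_floor_add_one ((K : ℝ) / 2 * Real.log T)
  have h4 : (1 : ℝ) / 2 * Real.log T - 1 ≤ fixLen K T * (1 / K) := by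
    rw [mul_one_div, le_div_iff₀ (by linarith)]
    unfold fixLen
    nlinarith
  calc (1 - 1 / (K : ℝ)) ^ fixLen K T ≤ Real.exp (-(1 / K)) ^ fixLen K T :=
        pow_le_pow_left₀ (by linarith) h2 _
    _ = Real.exp (-(fixLen K T * (1 / K))) := by rw [← Real.exp_nat_mul]; ring_nf
    _ ≤ Real.exp (1 + -(1 / 2 * Real.log T)) := by
        rw [Real.exp_le_exp]; linarith
    _ = Real.exp 1 * (1 / Real.sqrt T) := by rw [Real.exp_add, exp_neg_half_log hT]
    _ ≤ 3 * (1 / Real.sqrt T) := by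
        have := Real.exp_one_lt_three
        gcongr
    _ = _ := by ring

end Parameters

/-! ### The number of failing epochs -/

section Failure

variable {Ω : Type*} [MeasurableSpace Ω] {ι : Type*} [DecidableEq ι] [Fintype ι]
  {K : ℕ} [NeZero K]

lemma measurableSet_goodEpoch {U : ι → ℕ → Ω → Fin K} {X : ι → ℕ → Fin K → Ω → ℝ}
    (hU : ∀ j t, Measurable (U j t)) (hX : ∀ j t k, Measurable (X j t k)) (P : Finset ι)
    (μ : Fin K → ℝ) (τ T₀ : ℕ) (θ : ℝ) (t₀ : ℕ) :
    MeasurableSet {ω | GoodEpoch P μ τ T₀ θ (fun s j => U j (t₀ + s) ω)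
      (fun s j k => X j (t₀ + s) k ω)} := by
  have h : {ω | GoodEpoch P μ τ T₀ θ (fun s j => U j (t₀ + s) ω)
      (fun s j k => X j (t₀ + s) k ω)} =
      (⋂ j ∈ P, (fun ω => chairs P (fun s i => U i (t₀ + s) ω) τ) ⁻¹' {c | (c j).1 = true}) ∩
      ⋂ j ∈ P, ⋂ a, ⋂ k, {ω | |∑ t ∈ tailSet τ T₀ a k, X j (t₀ + t) k ω -
        (tailSet τ T₀ a k).card * μ k| ≤ (tailSet τ T₀ a k).card * θ} := by
    ext ω
    simp only [Set.mem_ofPred_eq, Set.mem_inter_iff, Set.mem_iInter, Set.mem_preimage]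
    exact ⟨fun h => ⟨h.1, h.2⟩, fun h => ⟨h.1, h.2⟩⟩
  rw [h]
  refine (Finset.measurableSet_biInter _ fun j _ => measurable_chairs hU P t₀ τ
    (Set.toFinite _).measurableSet).inter (Finset.measurableSet_biInter _ fun j _ =>
    MeasurableSet.iInter fun a => MeasurableSet.iInter fun k => measurableSet_le ?_ ?_)
  · exact ((Finset.measurable_sum _ fun t _ => hX j (t₀ + t) k).sub_const _).abs
  · exact measurable_const

/-- The probability that an epoch is not good. -/
lemma measureReal_not_goodEpoch_le {Pr : Measure Ω} [IsProbabilityMeasure Pr]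
    {ν : Fin K → Measure ℝ} {μ : Fin K → ℝ} {U : ι → ℕ → Ω → Fin K} {X : ι → ℕ → Fin K → Ω → ℝ}
    (hR : RandomInputs Pr ν U X) (hν : ∀ k, ∀ᵐ y ∂(ν k), y ∈ Set.Icc (0 : ℝ) 1)
    (hμ : ∀ k, μ k = ∫ y, y ∂(ν k)) {P : Finset ι} (hP : P.card ≤ K) {τ T₀ : ℕ} {θ n₀ q₁ q₂ : ℝ}
    (hθ : 0 ≤ θ) (hn : n₀ ≤ ((T₀ - τ) / K : ℕ)) (hq₁ : (1 - 1 / (K : ℝ)) ^ τ ≤ q₁)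
    (hq₂ : Real.exp (-(2 * n₀ * θ ^ 2)) ≤ q₂) (t₀ : ℕ) :
    Pr.real {ω | ¬ GoodEpoch P μ τ T₀ θ (fun s j => U j (t₀ + s) ω)
      (fun s j k => X j (t₀ + s) k ω)} ≤ K * q₁ + K * (K * (K * (2 * q₂))) := by
  have hlaw : ∀ i t k, Pr.real (U i t ⁻¹' {k}) = 1 / (K : ℝ) := by
    intro i t k
    rw [measureReal_def, hR.law_U]
    simp
  have hq₂0 : 0 ≤ q₂ := (Real.exp_pos _).le.trans hq₂
  have hPK : (P.card : ℝ) ≤ K := by exact_mod_cast hP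
  have hq₁0 : 0 ≤ q₁ := by
    refine le_trans (pow_nonneg ?_ _) hq₁
    have : (1 : ℝ) ≤ K := by exact_mod_cast Nat.pos_of_ne_zero (NeZero.ne K)
    rw [sub_nonneg, div_le_one (by linarith)]
    exact this
  set A : ι → Set Ω := fun j => {ω | (chairs P (fun s i => U i (t₀ + s) ω) τ j).1 = false}
  set B : ι → Fin K → Fin K → Set Ω := fun j a k => {ω | (tailSet τ T₀ a k).card * θ <
    |∑ t ∈ tailSet τ T₀ a k, X j (t₀ + t) k ω - (tailSet τ T₀ a k).card * μ k|}
  have hA : ∀ j ∈ P, Pr.real (A j) ≤ q₁ := fun j hj =>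
    (measureReal_not_fixed_le hR.meas_U hlaw hR.indep_U hP hj t₀ τ).trans hq₁
  have hB : ∀ j a k, Pr.real (B j a k) ≤ 2 * q₂ := by
    intro j a k
    have hmap : ∀ t, Pr.map (X j (t₀ + t) k) = ν k := fun t => hR.law_X j (t₀ + t) k
    have h1 := measureReal_abs_sum_sub_gt_le (Pr := Pr) (Z := fun t => X j (t₀ + t) k) (m := μ k)
      (θ := θ) (fun t => hR.meas_X j (t₀ + t) k)
      (hR.indep_X.precomp (g := fun t : ℕ => (j, t₀ + t, k)) (fun s t h => by
        simpa using h))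
      (fun t => by
        have h2 := hν k
        rw [← hmap t] at h2
        exact ae_of_ae_map (hR.meas_X j (t₀ + t) k).aemeasurable h2)
      (fun t => by
        rw [hμ k, ← hmap t]
        exact (integral_map (f := fun y => y) (hR.meas_X j (t₀ + t) k).aemeasurable
          measurable_id.aestronglyMeasurable).symm)
      hθ (tailSet τ T₀ a k)
    refine h1.trans ?_
    have h3 : n₀ ≤ ((tailSet τ T₀ a k).card : ℝ) :=
      hn.trans (by exact_mod_cast div_le_card_tailSet _ _ _ _)
    have h4 : Real.exp (-(2 * (tailSet τ T₀ a k).card * θ ^ 2)) ≤ q₂ := by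
      refine le_trans ?_ hq₂
      rw [Real.exp_le_exp]
      have := mul_le_mul_of_nonneg_right h3 (sq_nonneg θ)
      linarith
    linarith
  have hsub : {ω | ¬ GoodEpoch P μ τ T₀ θ (fun s j => U j (t₀ + s) ω)
      (fun s j k => X j (t₀ + s) k ω)} ⊆
      (⋃ j ∈ P, A j) ∪ ⋃ j ∈ P, ⋃ a ∈ Finset.univ, ⋃ k ∈ Finset.univ, B j a k := by
    intro ω hω
    by_contra hc
    simp only [Set.mem_union, Set.mem_iUnion, not_or, not_exists] at hc
    refine hω ⟨fun j hj => ?_, fun j hj a k => ?_⟩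
    · simpa [A] using hc.1 j hj
    · exact not_lt.1 (hc.2 j hj a (Finset.mem_univ _) k (Finset.mem_univ _))
  have hsumA : Pr.real (⋃ j ∈ P, A j) ≤ K * q₁ :=
    calc _ ≤ ∑ j ∈ P, Pr.real (A j) := measureReal_biUnion_finset_le _ _
      _ ≤ ∑ j ∈ P, q₁ := Finset.sum_le_sum hA
      _ = P.card * q₁ := by rw [Finset.sum_const, nsmul_eq_mul]
      _ ≤ K * q₁ := by gcongr
  have hsumB : Pr.real (⋃ j ∈ P, ⋃ a ∈ Finset.univ, ⋃ k ∈ Finset.univ, B j a k) ≤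
      K * (K * (K * (2 * q₂))) :=
    calc _ ≤ ∑ j ∈ P, ∑ a : Fin K, ∑ k : Fin K, Pr.real (B j a k) := by
          refine (measureReal_biUnion_finset_le _ _).trans (Finset.sum_le_sum fun j _ => ?_)
          refine (measureReal_biUnion_finset_le _ _).trans (Finset.sum_le_sum fun a _ => ?_)
          exact measureReal_biUnion_finset_le _ _
      _ ≤ ∑ j ∈ P, ∑ a : Fin K, ∑ k : Fin K, 2 * q₂ := by
          gcongr with j _ a _ k _
          exact hB j a k
      _ = P.card * (K * (K * (2 * q₂))) := by simp
      _ ≤ _ := by gcongr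
  calc _ ≤ _ := measureReal_mono hsub (measure_ne_top _ _)
    _ ≤ _ := measureReal_union_le _ _
    _ ≤ _ := add_le_add hsumA hsumB

omit [DecidableEq ι] [Fintype ι] [NeZero K] in
open scoped Classical in
/-- Markov's inequality for the number of events that occur. -/
lemma exists_card_filter_le {Pr : Measure Ω} [IsProbabilityMeasure Pr] (E : Finset ℕ)
    {F : ℕ → Set Ω} (hF : ∀ e ∈ E, MeasurableSet (F e)) {q δ : ℝ} (hq : 0 < q) (hδ : 0 < δ)
    (hFq : ∀ e ∈ E, Pr.real (F e) ≤ q) :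
    ∃ G : Set Ω, MeasurableSet G ∧ 1 - δ ≤ Pr.real G ∧
      ∀ ω ∈ G, ((E.filter (fun e => ω ∈ F e)).card : ℝ) ≤ E.card * q / δ := by
  rcases E.eq_empty_or_nonempty with rfl | hE
  · exact ⟨Set.univ, MeasurableSet.univ, by simp [hδ.le], by simp⟩
  set f : Ω → ℝ := fun ω => ∑ e ∈ E, (F e).indicator (fun _ => (1 : ℝ)) ω with hf
  have hfm : Measurable f := Finset.measurable_sum _ fun e he =>
    measurable_const.indicator (hF e he)
  have hfcard : ∀ ω, f ω = (E.filter (fun e => ω ∈ F e)).card := by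
    intro ω
    simp [hf, Set.indicator_apply]
  have hint : ∀ e ∈ E, Integrable ((F e).indicator (fun _ => (1 : ℝ))) Pr := fun e he =>
    (integrable_const _).indicator (hF e he)
  have hI : ∫ ω, f ω ∂Pr ≤ E.card * q := by
    rw [hf, integral_finsetSum _ hint]
    calc _ ≤ ∑ e ∈ E, q := by
          refine Finset.sum_le_sum fun e he => ?_
          rw [integral_indicator_const _ (hF e he)]
          simpa using hFq e he
      _ = _ := by rw [Finset.sum_const, nsmul_eq_mul]
  have hE' : (0 : ℝ) < E.card := by exact_mod_cast Finset.card_pos.2 hE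
  set M : ℝ := E.card * q / δ with hM
  have hMpos : 0 < M := by positivity
  have hmarkov := mul_meas_ge_le_integral_of_nonneg (μ := Pr) (f := f)
    (Filter.Eventually.of_forall fun ω => by rw [hfcard]; positivity)
    (integrable_finsetSum _ hint) M
  have h1 : Pr.real {ω | M ≤ f ω} ≤ δ := by
    have h2 : M * Pr.real {ω | M ≤ f ω} ≤ M * δ := by
      refine hmarkov.trans (hI.trans (le_of_eq ?_))
      rw [hM]; field_simp
    exact le_of_mul_le_mul_left h2 hMpos
  refine ⟨{ω | M ≤ f ω}ᶜ, (measurableSet_le measurable_const hfm).compl, ?_, ?_⟩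
  · rw [probReal_compl_eq_one_sub (measurableSet_le measurable_const hfm)]
    linarith
  · intro ω hω
    rw [← hfcard]
    have h2 : ¬ M ≤ f ω := by simpa using hω
    exact (not_le.1 h2).le

end Failure

/-! ### Counting the bad rounds -/

section Counting

variable {ι : Type*} [Fintype ι] [DecidableEq ι] {K : ℕ} [NeZero K]

/-- The epochs during which a player enters or leaves. -/
noncomputable def Run.disturbed (R : Run ι K) (T : ℕ) : Finset ℕ :=
  (Finset.univ.filter (fun j => 0 < R.arr j ∧ R.arr j < T)).image (fun j => R.arr j / R.Tep) ∪
    (Finset.univ.filter (fun j => R.dep j < T)).image (fun j => R.dep j / R.Tep)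

omit [DecidableEq ι] [NeZero K] in
lemma Run.card_disturbed_le (R : Run ι K) {T x : ℕ}
    (hent : (Finset.univ.filter (fun j => 0 < R.arr j ∧ R.arr j < T)).card ≤ x)
    (hlea : (Finset.univ.filter (fun j => R.dep j < T)).card ≤ x) :
    (R.disturbed T).card ≤ 2 * x := by
  refine (Finset.card_union_le _ _).trans ?_
  have h1 := (Finset.card_image_le (f := fun j => R.arr j / R.Tep)).trans hent
  have h2 := (Finset.card_image_le (f := fun j => R.dep j / R.Tep)).trans hlea
  omega

omit [DecidableEq ι] [NeZero K] in
lemma Run.present_eq_of_notMem_disturbed (R : Run ι K) {T e s : ℕ} (he : e ∉ R.disturbed T)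
    (hs : s < R.Tep) (hsT : e * R.Tep + s < T) :
    R.present (e * R.Tep + s) = R.present (e * R.Tep) := by
  have hdiv : ∀ t, e * R.Tep ≤ t → t ≤ e * R.Tep + s → t / R.Tep = e := by
    intro t h1 h2
    exact Nat.div_eq_of_lt_le h1 (by rw [add_mul, one_mul]; omega)
  have harr : ∀ j, ¬ (e * R.Tep < R.arr j ∧ R.arr j ≤ e * R.Tep + s) := by
    rintro j ⟨h1, h2⟩
    exact he (Finset.mem_union_left _ (Finset.mem_image.2
      ⟨j, Finset.mem_filter.2 ⟨Finset.mem_univ _, by omega, by omega⟩, hdiv _ h1.le h2⟩))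
  have hdep : ∀ j, ¬ (e * R.Tep < R.dep j ∧ R.dep j ≤ e * R.Tep + s) := by
    rintro j ⟨h1, h2⟩
    exact he (Finset.mem_union_right _ (Finset.mem_image.2
      ⟨j, Finset.mem_filter.2 ⟨Finset.mem_univ _, by omega⟩, hdiv _ h1.le h2⟩))
  ext j
  have h1 := harr j
  have h2 := hdep j
  simp only [Run.present, Finset.mem_filter, Finset.mem_univ, true_and]
  omega

/-- If all epochs outside `F` are good, then regret and collisions are at most `K` times the
number of rounds in bad epochs and in learning and trekking phases. -/
lemma Run.regret_collisions_le (R : Run ι K) {μ : Fin K → ℝ} {T x τ : ℕ} {θ ε n₀ : ℝ}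
    (hTep : 0 < R.Tep) (hcard : ∀ t < T, (R.present t).card ≤ K)
    (hent : (Finset.univ.filter (fun j => 0 < R.arr j ∧ R.arr j < T)).card ≤ x)
    (hlea : (Finset.univ.filter (fun j => R.dep j < T)).card ≤ x)
    (hμ : ∀ k, μ k ∈ Set.Icc (0 : ℝ) 1) (hgap : ∀ i k, i ≠ k → ε < |μ i - μ k|)
    (hε : 0 < ε) (hθ : 0 ≤ θ) (hn₀ : 0 < n₀) (hτ : τ ≤ R.T₀) (hT : 0 < R.T₀)
    (hnn : n₀ ≤ ((R.T₀ - τ) / K : ℕ)) (hacc : τ / n₀ + 2 * θ ≤ ε)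
    (hX : ∀ t < T, ∀ j k, R.X j t k ∈ Set.Icc (0 : ℝ) 1) (F : Finset ℕ)
    (hF : ∀ e, e * R.Tep < T → e ∉ F → GoodEpoch (R.present (e * R.Tep)) μ τ R.T₀ θ
      (R.draws (e * R.Tep)) (R.rewards (e * R.Tep))) :
    R.regret μ T ≤
        K * (((2 * x + F.card) * R.Tep + (T / R.Tep + 1) * (R.T₀ + K * K) : ℕ) : ℝ) ∧
      (R.collisions T : ℝ) ≤
        K * (((2 * x + F.card) * R.Tep + (T / R.Tep + 1) * (R.T₀ + K * K) : ℕ) : ℝ) := by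
  set bad : Finset ℕ := ((R.disturbed T ∪ F) ×ˢ Finset.range R.Tep ∪
    Finset.range (T / R.Tep + 1) ×ˢ Finset.range (R.T₀ + K * K)).image
      (fun p => p.1 * R.Tep + p.2) with hbad
  have hbadcard : bad.card ≤ (2 * x + F.card) * R.Tep + (T / R.Tep + 1) * (R.T₀ + K * K) := by
    refine Finset.card_image_le.trans ((Finset.card_union_le _ _).trans ?_)
    rw [Finset.card_product, Finset.card_product, Finset.card_range, Finset.card_range,
      Finset.card_range]
    have h1 : (R.disturbed T ∪ F).card ≤ 2 * x + F.card :=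
      (Finset.card_union_le _ _).trans (Nat.add_le_add_right (R.card_disturbed_le hent hlea) _)
    gcongr
  have hgood : ∀ t ∈ Finset.range T, t ∉ bad →
      R.roundRegret μ t = 0 ∧ R.roundCollisions t = 0 := by
    intro t ht htb
    rw [Finset.mem_range] at ht
    have hdm : t / R.Tep * R.Tep + t % R.Tep = t := Nat.div_add_mod' t R.Tep
    have hmod : t % R.Tep < R.Tep := Nat.mod_lt _ hTep
    have h1 : t / R.Tep ∉ R.disturbed T ∪ F := by
      intro h
      exact htb (Finset.mem_image.2 ⟨(t / R.Tep, t % R.Tep), Finset.mem_union_left _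
        (Finset.mem_product.2 ⟨h, Finset.mem_range.2 hmod⟩), hdm⟩)
    have h2 : R.T₀ + K * K ≤ t % R.Tep := by
      by_contra h
      exact htb (Finset.mem_image.2 ⟨(t / R.Tep, t % R.Tep), Finset.mem_union_right _
        (Finset.mem_product.2 ⟨Finset.mem_range.2
          (Nat.lt_succ_of_le (Nat.div_le_div_right ht.le)), Finset.mem_range.2 (by omega)⟩), hdm⟩)
    rw [Finset.mem_union, not_or] at h1
    have h3 := R.round_eq_zero (e := t / R.Tep) (n := t % R.Tep + 1) (s := t % R.Tep)
      (P := R.present (t / R.Tep * R.Tep)) hmod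
      (fun s hs => R.present_eq_of_notMem_disturbed h1.1 (by omega) (by omega))
      (hcard _ (by omega)) (hF _ (by omega) h1.2) hμ hgap hε hθ hn₀ hτ hT hnn hacc
      (fun s hs j _ k => hX _ (by omega) j k) (Nat.lt_succ_self _) h2
    rwa [hdm] at h3
  have hK : (0 : ℝ) ≤ K := Nat.cast_nonneg _
  have hcount : ∀ f : ℕ → ℝ, (∀ t ∈ Finset.range T, f t ≤ K) →
      (∀ t ∈ Finset.range T, t ∉ bad → f t = 0) → ∑ t ∈ Finset.range T, f t ≤
        K * (((2 * x + F.card) * R.Tep + (T / R.Tep + 1) * (R.T₀ + K * K) : ℕ) : ℝ) := by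
    intro f hf1 hf2
    calc ∑ t ∈ Finset.range T, f t ≤ ∑ t ∈ Finset.range T, if t ∈ bad then (K : ℝ) else 0 := by
          refine Finset.sum_le_sum fun t ht => ?_
          split_ifs with h
          · exact hf1 t ht
          · exact (hf2 t ht h).le
      _ = ((Finset.range T).filter (· ∈ bad)).card * (K : ℝ) := by
          rw [← Finset.sum_filter, Finset.sum_const, nsmul_eq_mul]
      _ ≤ bad.card * (K : ℝ) := by
          gcongr
          intro t ht
          exact (Finset.mem_filter.1 ht).2
      _ ≤ (((2 * x + F.card) * R.Tep + (T / R.Tep + 1) * (R.T₀ + K * K) : ℕ) : ℝ) * K := by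
          gcongr
      _ = _ := mul_comm _ _
  constructor
  · rw [R.regret_eq_sum]
    exact hcount _ (fun t _ => R.roundRegret_le hμ t) fun t ht h => (hgood t ht h).1
  · have h1 : (R.collisions T : ℝ) = ∑ t ∈ Finset.range T, (R.roundCollisions t : ℝ) := by
      rw [← Nat.cast_sum]
      rfl
    rw [h1]
    refine hcount _ (fun t ht => ?_) fun t ht h => by rw [(hgood t ht h).2, Nat.cast_zero]
    exact_mod_cast R.roundCollisions_le (hcard t (Finset.mem_range.1 ht))

lemma Run.regret_collisions_le_trivial (R : Run ι K) {μ : Fin K → ℝ} {T : ℕ}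
    (hcard : ∀ t < T, (R.present t).card ≤ K) (hμ : ∀ k, μ k ∈ Set.Icc (0 : ℝ) 1) :
    R.regret μ T ≤ K * T ∧ (R.collisions T : ℝ) ≤ K * T := by
  constructor
  · rw [R.regret_eq_sum, mul_comm]
    refine (Finset.sum_le_card_nsmul _ _ (K : ℝ) fun t _ => R.roundRegret_le hμ t).trans ?_
    rw [Finset.card_range, nsmul_eq_mul]
  · have h1 : R.collisions T ≤ K * T := by
      rw [mul_comm]
      refine (Finset.sum_le_card_nsmul _ _ K fun t ht =>
        R.roundCollisions_le (hcard t (Finset.mem_range.1 ht))).trans ?_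
      rw [Finset.card_range, smul_eq_mul]
    exact_mod_cast h1

end Counting

/-! ### The epoch length -/

section EpochLength

variable {K T x T₀ : ℕ} {Ttr : ℝ}

lemma sqrt_div_le_epochLen (hK : 2 ≤ K) (hx : 1 ≤ x) (hTtr : 1 ≤ Ttr) :
    Real.sqrt (T / x) ≤ epochLen K T x T₀ Ttr := by
  have hK' : (2 : ℝ) ≤ K := by exact_mod_cast hK
  have hx' : (1 : ℝ) ≤ x := by exact_mod_cast hx
  have hT₀ : (0 : ℝ) ≤ T₀ := Nat.cast_nonneg _
  have h1 : Real.sqrt (T / x) ≤ Real.sqrt (T * K * (T₀ + Ttr) / (2 * x)) := by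
    apply Real.sqrt_le_sqrt
    rw [div_le_div_iff₀ (by linarith) (by linarith)]
    have h2 : (2 : ℝ) ≤ K * (T₀ + Ttr) := by nlinarith
    have h3 : (0 : ℝ) ≤ T * x := by positivity
    nlinarith [mul_le_mul_of_nonneg_left h2 h3]
  refine h1.trans ((Nat.le_ceil _).trans ?_)
  have h2 : ⌈Real.sqrt (T * K * (T₀ + Ttr) / (2 * x))⌉₊ ≤ epochLen K T x T₀ Ttr :=
    le_max_right _ _
  exact Nat.cast_le.2 h2

lemma epochLen_le (hTtr : 0 ≤ Ttr) :
    (epochLen K T x T₀ Ttr : ℝ) ≤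
      T₀ + Real.sqrt (T / x) * Real.sqrt (K * (T₀ + Ttr)) + 1 := by
  have h0 : (0 : ℝ) ≤ K * (T₀ + Ttr) := by positivity
  have h1 : Real.sqrt (T * K * (T₀ + Ttr) / (2 * x)) ≤
      Real.sqrt (T / x) * Real.sqrt (K * (T₀ + Ttr)) := by
    rw [← Real.sqrt_mul (by positivity)]
    apply Real.sqrt_le_sqrt
    have h2 : T * K * (T₀ + Ttr) / (2 * x) = T / x * (K * (T₀ + Ttr)) / 2 := by ring
    rw [h2]
    have : (0 : ℝ) ≤ T / x * (K * (T₀ + Ttr)) := by positivity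
    linarith
  have h2 := Nat.ceil_lt_add_one (Real.sqrt_nonneg (T * K * (T₀ + Ttr) / (2 * x)))
  have h3 : (0 : ℝ) ≤ T₀ := Nat.cast_nonneg _
  rw [epochLen, Nat.cast_max]
  refine max_le ?_ ?_
  · have : 0 ≤ Real.sqrt (T / x) * Real.sqrt (K * (T₀ + Ttr)) := by positivity
    linarith
  · linarith

lemma trekLen_bounds (v : Trek) : 1 ≤ trekLen K v ∧ (1 ≤ K → trekLen K v ≤ K ^ 2 + 1) := by
  cases v with
  | up =>
    have : (0 : ℝ) ≤ (K : ℝ) ^ 2 / 2 := by positivity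
    constructor
    · simp only [trekLen]; linarith
    · intro _; simp only [trekLen]; linarith
  | down =>
    constructor
    · simp only [trekLen]; nlinarith [mul_self_nonneg ((K : ℝ) - 1)]
    · intro h
      have : (1 : ℝ) ≤ K := by exact_mod_cast h
      simp only [trekLen]; nlinarith

/-- The number of bad rounds is `O(√(x T) log T)`. -/
lemma bad_rounds_le {c f : ℝ} (hK : 2 ≤ K) (hT : 2 ≤ T) (hx : 1 ≤ x) (hxT : x ≤ T)
    (hc : 0 ≤ c) (hT₀ : (T₀ : ℝ) ≤ c * Real.log T) (hTtr : 1 ≤ Ttr) (hTtr' : Ttr ≤ K ^ 2 + 1)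
    (hf : 0 ≤ f) {m : ℕ}
    (hm : (m : ℝ) ≤ (T / epochLen K T x T₀ Ttr + 1 : ℕ) * (f / Real.sqrt T)) :
    (((2 * x + m) * epochLen K T x T₀ Ttr +
        (T / epochLen K T x T₀ Ttr + 1) * (T₀ + K * K) : ℕ) : ℝ) ≤
      ((2 + 2 * f) * (c + K * (c + 2 * (K ^ 2 + 1)) + 2) + 2 * (c + 2 * (K * K))) *
        Real.sqrt (x * T) * Real.log T := by
  have hK' : (2 : ℝ) ≤ K := by exact_mod_cast hK
  have hx' : (1 : ℝ) ≤ x := by exact_mod_cast hx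
  have hT' : (2 : ℝ) ≤ T := by exact_mod_cast hT
  have hxT' : (x : ℝ) ≤ T := by exact_mod_cast hxT
  have hl := half_lt_log hT
  set l := Real.log T
  set E := epochLen K T x T₀ Ttr
  set s := Real.sqrt (x * T)
  set r := Real.sqrt (T / x)
  have hr1 : 1 ≤ r := Real.one_le_sqrt.2 ((one_le_div (by linarith)).2 hxT')
  have hs1 : 1 ≤ s := Real.one_le_sqrt.2 (by nlinarith)
  have hrE : r ≤ E := sqrt_div_le_epochLen hK hx hTtr
  have hxr : x * r = s := by
    have h1 : (x : ℝ) * r = Real.sqrt (x * x) * r := by rw [Real.sqrt_mul_self (by linarith)]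
    rw [h1, ← Real.sqrt_mul (by positivity)]
    congr 1
    field_simp
  have hsr : s * r = T := by
    rw [← Real.sqrt_mul (by positivity)]
    have h1 : (x : ℝ) * T * (T / x) = T * T := by field_simp
    rw [h1, Real.sqrt_mul_self (by linarith)]
  have hsx : s = Real.sqrt x * Real.sqrt T := Real.sqrt_mul (by linarith) _
  have hepochs : ((T / E + 1 : ℕ) : ℝ) ≤ 2 * s := by
    have h1 : ((T / E : ℕ) : ℝ) ≤ T / E := Nat.cast_div_le
    have h2 : (T : ℝ) / E ≤ s := by
      rw [div_le_iff₀ (by linarith), ← hsr]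
      gcongr
    push_cast
    linarith
  have hmx : (m : ℝ) ≤ 2 * f * x := by
    have hsT : 0 < Real.sqrt T := Real.sqrt_pos.2 (by linarith)
    have hsx1 : Real.sqrt x ≤ x := by
      rw [Real.sqrt_le_left (by linarith)]
      nlinarith
    calc (m : ℝ) ≤ (T / E + 1 : ℕ) * (f / Real.sqrt T) := hm
      _ ≤ 2 * s * (f / Real.sqrt T) := by gcongr
      _ = 2 * f * Real.sqrt x := by rw [hsx]; field_simp
      _ ≤ 2 * f * x := by gcongr
  have hEle : (E : ℝ) ≤ (c + K * (c + 2 * (K ^ 2 + 1)) + 2) * l * r := by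
    have h1 : (E : ℝ) ≤ T₀ + r * Real.sqrt (K * (T₀ + Ttr)) + 1 := epochLen_le (by linarith)
    have h0 : (0 : ℝ) ≤ T₀ := Nat.cast_nonneg _
    have h2 : 1 ≤ K * (T₀ + Ttr) := by nlinarith
    have h3 : Real.sqrt (K * (T₀ + Ttr)) ≤ K * (T₀ + Ttr) := by
      rw [Real.sqrt_le_left (by linarith)]
      nlinarith
    have h4 : K * (T₀ + Ttr) ≤ K * (c + 2 * (K ^ 2 + 1)) * l := by
      have h7 : ((K : ℝ) ^ 2 + 1) * 1 ≤ (K ^ 2 + 1) * (2 * l) :=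
        mul_le_mul_of_nonneg_left (by linarith) (by positivity)
      rw [mul_assoc]
      exact mul_le_mul_of_nonneg_left (by linarith) (by linarith)
    have h5 : r * Real.sqrt (K * (T₀ + Ttr)) ≤ r * (K * (c + 2 * (K ^ 2 + 1)) * l) := by
      gcongr
      exact h3.trans h4
    have h6 : (T₀ : ℝ) + 1 ≤ (c + 2) * l * r := by
      have h7 : (T₀ : ℝ) + 1 ≤ (c + 2) * l := by linarith
      exact h7.trans (le_mul_of_one_le_right (mul_nonneg (by linarith) (by linarith)) hr1)
    calc (E : ℝ) ≤ (c + 2) * l * r + r * (K * (c + 2 * (K ^ 2 + 1)) * l) := by linarith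
      _ = _ := by ring
  have hsecond : (T₀ : ℝ) + K * K ≤ (c + 2 * (K * K)) * l := by
    have h1 : (K * K : ℝ) * 1 ≤ K * K * (2 * l) :=
      mul_le_mul_of_nonneg_left (by linarith) (by positivity)
    linarith
  push_cast at hepochs ⊢
  calc (2 * (x : ℝ) + m) * E + ((T / E : ℕ) + 1) * (T₀ + K * K)
      ≤ (2 * x + 2 * f * x) * ((c + K * (c + 2 * (K ^ 2 + 1)) + 2) * l * r) +
        2 * s * ((c + 2 * (K * K)) * l) := by
          refine add_le_add (mul_le_mul ?_ hEle (Nat.cast_nonneg _) (by positivity))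
            (mul_le_mul hepochs hsecond (by positivity) (by positivity))
          linarith
    _ = ((2 + 2 * f) * (c + K * (c + 2 * (K ^ 2 + 1)) + 2)) * (x * r) * l +
        2 * (c + 2 * (K * K)) * s * l := by ring
    _ = _ := by rw [hxr]; ring

end EpochLength

end DynTrek

open DynTrek
theorem theorem3 :
    ∃ p : ℕ, ∀ (K : ℕ) [NeZero K], 2 ≤ K → ∀ (v : Trek) (ε δ : ℝ), 0 < ε → 0 < δ → δ < 1 →
    ∃ A : ℝ, ∀ (T x : ℕ), 2 ≤ T → 1 ≤ x →
      -- the reward laws on `[0,1]`, with means `μ` separated by more than `ε`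
      ∀ (ν : Fin K → Measure ℝ) (μ : Fin K → ℝ), (∀ k, IsProbabilityMeasure (ν k)) →
      (∀ k, ∀ᵐ y ∂(ν k), y ∈ Set.Icc (0 : ℝ) 1) → (∀ k, μ k = ∫ y, y ∂(ν k)) →
      (∀ i k, i ≠ k → ε < |μ i - μ k|) →
      -- the players, with their entering and leaving times
      ∀ {ι : Type*} [Fintype ι] [DecidableEq ι] (arr dep : ι → ℕ),
      Admissible K T x (learnLen K ε (δ / T))
        (epochLen K T x (learnLen K ε (δ / T)) (trekLen K v)) (trekLen K v) arr dep →
      ∀ {Ω : Type*} [MeasurableSpace Ω] (P : Measure Ω) [IsProbabilityMeasure P]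
        (U : ι → ℕ → Ω → Fin K) (X : ι → ℕ → Fin K → Ω → ℝ) (W : ι → ℕ → Ω → Option (Fin K)),
      RandomInputs P ν U X →
      ∃ E : Set Ω, MeasurableSet E ∧ ENNReal.ofReal (1 - δ) ≤ P E ∧ ∀ ω ∈ E,
        let R : Run ι K := dtRun v ε δ T x arr dep (fun j t => U j t ω) (fun j t k => X j t k ω)
          (fun j t => W j t ω)
        R.regret μ T ≤ A * Real.sqrt ((x : ℝ) * T) * Real.log T ^ p ∧
        (R.collisions T : ℝ) ≤ A * Real.sqrt ((x : ℝ) * T) * Real.log T ^ p := by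
  refine ⟨1, fun K _ hK v ε δ hε hδ hδ1 => ?_⟩
  obtain ⟨c, hc, hcT⟩ := exists_learnLen_le hK ε hδ hδ1
  set f : ℝ := (3 * K + 2 * K ^ 3) / δ with hf
  have hf0 : 0 ≤ f := by positivity
  set B : ℝ := (2 + 2 * f) * (c + K * (c + 2 * (K ^ 2 + 1)) + 2) + 2 * (c + 2 * (K * K)) with hB
  have hB0 : 0 ≤ B := by positivity
  refine ⟨K * B + 2 * K, ?_⟩
  intro T x hT hx ν μ hνp hν hμν hgap ι _ _ arr dep hadm Ω _ P _ U X W hR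
  have hl := half_lt_log hT
  have hμ : ∀ k, μ k ∈ Set.Icc (0 : ℝ) 1 := by
    intro k
    have := hνp k
    rw [hμν k]
    exact ⟨integral_nonneg_of_ae ((hν k).mono fun y hy => hy.1), by
      simpa using integral_mono_of_nonneg ((hν k).mono fun y hy => hy.1)
        (integrable_const (1 : ℝ)) ((hν k).mono fun y hy => hy.2)⟩
  have hs0 : 0 ≤ Real.sqrt ((x : ℝ) * T) := Real.sqrt_nonneg _
  rcases lt_or_ge T x with hxT | hxT
  · refine ⟨Set.univ, MeasurableSet.univ, ?_, fun ω _ => ?_⟩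
    · rw [measure_univ, ← ENNReal.ofReal_one]
      exact ENNReal.ofReal_le_ofReal (by linarith)
    · intro R
      have h1 := R.regret_collisions_le_trivial (T := T) hadm.card_le hμ
      have h2 : (T : ℝ) ≤ Real.sqrt ((x : ℝ) * T) := by
        apply Real.le_sqrt_of_sq_le
        have : (T : ℝ) ≤ x := by exact_mod_cast hxT.le
        rw [sq]
        gcongr
      have h3 : (K : ℝ) * T ≤ (K * B + 2 * K) * Real.sqrt ((x : ℝ) * T) * Real.log T ^ 1 := by
        rw [pow_one]
        calc (K : ℝ) * T ≤ K * Real.sqrt ((x : ℝ) * T) := by gcongr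
          _ = 2 * K * Real.sqrt ((x : ℝ) * T) * (1 / 2) := by ring
          _ ≤ (K * B + 2 * K) * Real.sqrt ((x : ℝ) * T) * Real.log T := by
            gcongr
            have : 0 ≤ K * B := by positivity
            linarith
      exact ⟨h1.1.trans h3, h1.2.trans h3⟩
  set T₀ := learnLen K ε (δ / T)
  set Tep := epochLen K T x T₀ (trekLen K v)
  obtain ⟨hτ, hT₀, hnn⟩ := fixLen_le_learnLen hK hT hε hδ hδ1
  have hTtr := trekLen_bounds (K := K) v
  have hTep : 0 < Tep := by
    have h1 : Real.sqrt (T / x) ≤ Tep := sqrt_div_le_epochLen hK hx hTtr.1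
    have h2 : 0 < Real.sqrt ((T : ℝ) / x) := Real.sqrt_pos.2 (by positivity)
    exact_mod_cast h2.trans_le h1
  set pres : ℕ → Finset ι := fun t => Finset.univ.filter (fun j => arr j ≤ t ∧ t < dep j)
  set good : ℕ → Set Ω := fun e => {ω | GoodEpoch (pres (e * Tep)) μ (fixLen K T) T₀ (accuracy ε)
    (fun s j => U j (e * Tep + s) ω) (fun s j k => X j (e * Tep + s) k ω)}
  set epochs : Finset ℕ := (Finset.range (T / Tep + 1)).filter (fun e => e * Tep < T)
  have hsT : 0 < Real.sqrt T := Real.sqrt_pos.2 (by positivity)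
  obtain ⟨G, hGm, hGP, hG⟩ := exists_card_filter_le (Pr := P) epochs
    (F := fun e => (good e)ᶜ) (q := (3 * K + 2 * K ^ 3) / Real.sqrt T) (δ := δ)
    (fun e _ => (measurableSet_goodEpoch hR.meas_U hR.meas_X _ _ _ _ _ _).compl)
    (by have : 0 < K := by omega
        positivity) hδ
    (fun e he => by
      refine (measureReal_not_goodEpoch_le hR hν hμν
        (hadm.card_le _ (Finset.mem_filter.1 he).2) (accuracy_nonneg hε) hnn
        (one_sub_pow_fixLen_le hK hT) (q₂ := 1 / Real.sqrt T) ?_ (e * Tep)).trans (le_of_eq ?_)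
      · rw [← exp_neg_half_log hT, Real.exp_le_exp, neg_le_neg_iff]
        exact half_log_le_playBound_mul hε
      · field_simp)
  set Z : Set Ω := ⋂ t : ℕ, ⋂ j : ι, ⋂ k : Fin K, X j t k ⁻¹' Set.Icc (0 : ℝ) 1
  have hZm : MeasurableSet Z := MeasurableSet.iInter fun t => MeasurableSet.iInter fun j =>
    MeasurableSet.iInter fun k => hR.meas_X j t k measurableSet_Icc
  have hZ : ∀ᵐ ω ∂P, ω ∈ Z := by
    simp only [Z, Set.mem_iInter]
    rw [ae_all_iff]; intro t
    rw [ae_all_iff]; intro j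
    rw [ae_all_iff]; intro k
    have h := hν k
    rw [← hR.law_X j t k] at h
    exact ae_of_ae_map (hR.meas_X j t k).aemeasurable h
  refine ⟨G ∩ Z, hGm.inter hZm, ?_, fun ω hω => ?_⟩
  · have h1 : P (G ∩ Z) = P G := measure_congr (by
      filter_upwards [hZ] with ω hω
      exact propext ⟨fun h => h.1, fun h => ⟨h, hω⟩⟩)
    rw [h1]
    rw [measureReal_def] at hGP
    exact ENNReal.ofReal_le_of_le_toReal hGP
  · intro R
    classical
    have hGω := hG ω hω.1
    set F := epochs.filter (fun e => ω ∈ (good e)ᶜ)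
    have hmain := R.regret_collisions_le (T := T) (x := x) hTep hadm.card_le hadm.enter_le
      hadm.leave_le hμ hgap hε (accuracy_nonneg hε) (playBound_pos hε hT) hτ hT₀ hnn
      (fixLen_div_add_le hε hT (mul_gap_le_one hε hμ hgap))
      (fun t _ j k => by
        have := Set.mem_iInter.1 (Set.mem_iInter.1 (Set.mem_iInter.1 hω.2 t) j) k
        exact this) F
      (fun e he heF => by
        by_contra hng
        refine heF (Finset.mem_filter.2 ⟨Finset.mem_filter.2 ⟨?_, he⟩, hng⟩)
        rw [Finset.mem_range, Nat.lt_succ_iff, Nat.le_div_iff_mul_le hTep]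
        exact le_of_lt he)
    have hm : (F.card : ℝ) ≤ (T / Tep + 1 : ℕ) * (f / Real.sqrt T) := by
      have h1 : epochs.card ≤ T / Tep + 1 := by
        simpa using Finset.card_filter_le (Finset.range (T / Tep + 1)) (fun e => e * Tep < T)
      have h2 : (epochs.card : ℝ) ≤ (T / Tep + 1 : ℕ) := by exact_mod_cast h1
      calc (F.card : ℝ) ≤ epochs.card * ((3 * K + 2 * K ^ 3) / Real.sqrt T) / δ := by
            convert hGω
        _ = epochs.card * (f / Real.sqrt T) := by rw [hf]; field_simp
        _ ≤ _ := by gcongr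
    have hbound := bad_rounds_le hK hT hx hxT hc (hcT T hT) hTtr.1 (hTtr.2 (by omega)) hf0 hm
    have hfinal : (K : ℝ) * (((2 * x + F.card) * Tep + (T / Tep + 1) * (T₀ + K * K) : ℕ) : ℝ) ≤
        (K * B + 2 * K) * Real.sqrt ((x : ℝ) * T) * Real.log T ^ 1 := by
      rw [pow_one]
      calc _ ≤ K * (B * Real.sqrt ((x : ℝ) * T) * Real.log T) := by gcongr
        _ = K * B * Real.sqrt ((x : ℝ) * T) * Real.log T := by ring
        _ ≤ _ := by
          gcongr
          have : (0 : ℝ) ≤ 2 * K := by positivity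
          linarith
    exact ⟨hmain.1.trans hfinal, hmain.2.trans hfinal⟩
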